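/- For $Q\in\mathbb N$ let $\mathcal F_Q=\{p/q\in[0,1): p,q\in\mathbb Z,\ \gcd(p,q)=1,\ 0<q\le Q\}$ be the Farey points of level $Q$, regarded as points of $\mathbb T=\mathbb R/\mathbb Z$, and let $\sigma_Q=\frac{Q^2}{2\zeta(2)}=\frac{3Q^2}{\pi^2}$. For $\mathcal D\subset\mathbb T$, $A\subset\mathbb R$ and an integer $k\ge 0$ put $$P_{0,Q}(k,\mathcal D,A)=\frac{\big|\{r\in\mathcal F_Q\cap\mathcal D:\ |(r+\sigma_Q^{-1}A+\mathbb Z)\cap\mathcal F_Q|=k\}\big|}{|\mathcal F_Q\cap\mathcal D|}.$$ Let $\widehat{\mathbb Z}^2=\{(p,q)\in\mathbb Z^2:\gcd(p,q)=1\}$ (row vectors), let $\mathfrak C_\lambda(A)=\{(x\lambda^{1/2},y\lambda^{-1/2}): 0<y\le 1,\ x\in\sigma_1^{-1}yA\}$ for $0<\lambda\le1$, and put $$P_0(k,A)=\int_0^1 \operatorname{meas}\Big\{b\in[0,1):\ \Big|\widehat{\mathbb Z}^2\begin{pmatrix}1&b\\0&1\end{pmatrix}\cap\mathfrak C_\lambda(A)\Big|=k\Big\}\,d\lambda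 .$$ Let $s>0$ and $a=\big(\tfrac{\pi^2}{3}s\big)^{-1}$. Then: (i) For every $\mathcal D\subset\mathbb T$ with non-empty interior and with boundary of Lebesgue measure zero, $$\lim_{Q\to\infty}P_{0,Q}(0,\mathcal D,(0,s])=P_0(0,(0,s]).$$ (ii) The limiting gap distribution is $$P_0(0,(0,s])=\begin{cases}1 & \text{if } a\ge 1,\\ -1+2a-2a\log a & \text{if } \tfrac14\le a\le 1,\\ -1+2a+2\sqrt{\tfrac14-a}-4a\log\big(\tfrac12+\sqrt{\tfrac14-a}\big) & \text{if } 0<a\le\tfrac14.\end{cases}$$ (iii) The function $s\mapsto P_0(0,(0,s])$ is differentiable on $(0,\infty)$, and $$-\frac{d}{ds}P_0(0,(0,s])=\begin{cases}0 & \text{if } a\ge 1,\\ -\tfrac{2\pi^2}{3}a^2\log a & \text{if } \tfrac14\le a\le 1,\\ -\tfrac{4\pi^2}{3}a^2\log\big(\tfrac12+\sqrt{\tfrac14-a}\big) & \text{if } 0<a\le\tfrac14.\end{cases}$$ -/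

import Mathlib

open MeasureTheory Set Filter Topology
open scoped Matrix Pointwise

noncomputable section

namespace Farey

/-- The Farey points `p / q ∈ [0, 1)` of level `Q`: `gcd (p, q) = 1` and `0 < q ≤ Q`. -/
def points (Q : ℕ) : Set ℝ :=
  {x | x ∈ Ico (0 : ℝ) 1 ∧
    ∃ p q : ℤ, Int.gcd p q = 1 ∧ 0 < q ∧ q ≤ (Q : ℤ) ∧ x = (p : ℝ) / (q : ℝ)}

/-- The normalisation `σ_Q = Q² / (2 ζ(2))`, asymptotic to the number of Farey points. -/
def sigma (Q : ℕ) : ℝ := (Q : ℝ) ^ 2 / (2 * (riemannZeta 2).re)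

/-- The set `(r + σ_Q⁻¹ A + ℤ) ∩ F_Q`. -/
def near (Q : ℕ) (A : Set ℝ) (r : ℝ) : Set ℝ :=
  {x | ∃ t ∈ A, ∃ m : ℤ, x = r + (sigma Q)⁻¹ * t + (m : ℝ)} ∩ points Q

/-- The Farey points that lie in a subset `D` of the torus `𝕋 = ℝ / ℤ`. -/
def pointsIn (Q : ℕ) (D : Set UnitAddCircle) : Set ℝ :=
  {r | r ∈ points Q ∧ (r : UnitAddCircle) ∈ D}

/-- `P_{0,Q}(k, D, A)`: the proportion of the Farey points `r ∈ F_Q ∩ D` for which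
`(r + σ_Q⁻¹ A + ℤ) ∩ F_Q` has exactly `k` elements. -/
def P0Q (Q k : ℕ) (D : Set UnitAddCircle) (A : Set ℝ) : ℝ :=
  ({r | r ∈ pointsIn Q D ∧ (near Q A r).encard = (k : ℕ∞)}.ncard : ℝ) /
    ((pointsIn Q D).ncard : ℝ)

/-- The diagonal matrix `a(y) = diag (y, y⁻¹)`. -/
def aMat (y : ℝ) : Matrix (Fin 2) (Fin 2) ℝ := !![y, 0; 0, y⁻¹]

/-- The matrix with rows `(1, b)` and `(0, 1)`. These matrices form the stabiliser `H` of the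
row vector `(0, 1)` in `SL(2, ℝ)`, and those with `b ∈ ℤ` form `Γ_H = H ∩ SL(2, ℤ)`. -/
def hMat (b : ℝ) : Matrix (Fin 2) (Fin 2) ℝ := !![1, b; 0, 1]

/-- The primitive integer vectors `ℤ̂²`, as row vectors in `ℝ²`. -/
def primitive : Set (Fin 2 → ℝ) :=
  {v | ∃ p q : ℤ, Int.gcd p q = 1 ∧ v = ![(p : ℝ), (q : ℝ)]}

/-- The cone `{(x, y) : 0 < y ≤ 1, x ∈ σ_1⁻¹ y A}`. -/
def cone (A : Set ℝ) : Set (Fin 2 → ℝ) :=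
  {v | 0 < v 1 ∧ v 1 ≤ 1 ∧ v 0 ∈ ((sigma 1)⁻¹ * v 1) • A}

/-- The rescaled cone `cone A · a(√l)`; vectors are row vectors. -/
def coneScaled (l : ℝ) (A : Set ℝ) : Set (Fin 2 → ℝ) :=
  (fun v => v ᵥ* aMat (Real.sqrt l)) '' cone A

/-- `p_0(k, C) = μ_H {M ∈ Γ_H \ H : |ℤ̂² M ∩ C| = k}`. The quotient `Γ_H \ H` is the circle
`ℝ / ℤ` in the coordinate `b` of `hMat b`, with `[0, 1)` as a fundamental domain, and `μ_H` is
Lebesgue measure `db`. -/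
def p0 (k : ℕ) (C : Set (Fin 2 → ℝ)) : ℝ :=
  (volume : Measure ℝ).real {b | b ∈ Ico (0 : ℝ) 1 ∧
    (((fun v => v ᵥ* hMat b) '' primitive) ∩ C).encard = (k : ℕ∞)}

/-- `P_0(k, A) = ∫_0^1 p_0(k, cone A · a(√l)) dl`. -/
def P0 (k : ℕ) (A : Set ℝ) : ℝ :=
  ∫ l in (0 : ℝ)..1, p0 k (coneScaled l A)

end Farey

end

/-!
The Farey points of level `Q` correspond to the coprime pairs `(q, n)` with `q ≤ Q` and
`Q - q < n ≤ Q`: the point `p / q` with `p n ≡ -1` modulo `q` has the right neighbour of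
denominator `n`, at distance `1 / (q n)`. Hence the gap at `p / q`, scaled by `σ_Q`, exceeds `s` if
and only if `q n < a Q²`, which for a given `q` confines `n` to an interval of length about
`q * gapProfile a (q / Q)`, while `p / q ∈ D` is a condition on the inverse of `n` modulo `q`.

As `q → ∞` the points `(u / q, -u⁻¹ / q)`, with `u` running over the units modulo `q`, become
equidistributed in the torus: by Weyl's criterion this is the bound `o(φ(q))` for Kloosterman sums,
and counting the solutions of `a + b = c + d`, `a⁻¹ + b⁻¹ = c⁻¹ + d⁻¹` bounds their fourth moment,
which suffices. So about `vol(D) φ(q) gapProfile a (q / Q)` of the pairs with a given `q`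
contribute, and averaging over `q` gives `gapIntegral a`, independently of `D`.

On the horocycle side, if any primitive vector meets the cone then one of the form `(1, m)` does;
this makes the measure of the good `b` equal to `gapProfile a (√λ)`, and the substitution `λ = t²`
gives `gapIntegral a` once more.
-/

noncomputable section

namespace Farey

open scoped Finset Combinatorics.Additive

section Annihilator

variable {R : Type*} [CommRing R] [Fintype R] [DecidableEq R]

/-- The order of the annihilator of `x` in a finite commutative ring. -/
def annihilatorCard (x : R) : ℕ := #{y : R | x * y = 0}

lemma card_filter_mul_eq_le_annihilatorCard (x c : R) :
    #{y : R | x * y = c} ≤ annihilatorCard x := by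
  rcases Finset.eq_empty_or_nonempty ({y : R | x * y = c} : Finset R) with hempty | ⟨y₀, hy₀⟩
  · simp [hempty]
  · refine Finset.card_le_card_of_injOn (· - y₀) (fun y hy => ?_) (sub_left_injective.injOn)
    simp only [Finset.coe_filter, Finset.mem_filter, Finset.mem_univ, true_and,
      mem_ofPred_eq] at hy hy₀ ⊢
    rw [mul_sub, hy, hy₀, sub_self]

lemma annihilatorCard_mul_le (x y : R) :
    annihilatorCard (x * y) ≤ annihilatorCard x * annihilatorCard y := by
  rw [mul_comm (annihilatorCard x)]
  refine Finset.card_le_mul_card_image_of_maps_to (f := (y * ·)) (fun z hz => ?_) _ fun b _ => ?_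
  · simpa [mul_assoc] using hz
  · exact (Finset.card_le_card (Finset.filter_subset_filter _ (Finset.subset_univ _))).trans
      (card_filter_mul_eq_le_annihilatorCard y b)

end Annihilator

lemma norm_sum_addChar_pow_four {G ι : Type*} [AddCommGroup G] [Finite G] (ψ : AddChar G ℂ)
    (s : Finset ι) (f : ι → G) :
    ((‖∑ i ∈ s, ψ (f i)‖ ^ 4 : ℝ) : ℂ) =
      ∑ t ∈ (s ×ˢ s) ×ˢ s ×ˢ s, ψ (f t.1.1 - f t.1.2 + (f t.2.1 - f t.2.2)) := by
  have hsq : ((‖∑ i ∈ s, ψ (f i)‖ ^ 2 : ℝ) : ℂ) = ∑ x ∈ s ×ˢ s, ψ (f x.1 - f x.2) := by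
    rw [Complex.ofReal_pow, ← Complex.mul_conj', map_sum, Finset.sum_mul_sum,
      ← Finset.sum_product']
    simp only [← AddChar.map_neg_eq_conj, ← AddChar.map_add_eq_mul, sub_eq_add_neg]
  rw [show 4 = 2 * 2 from rfl, pow_mul, Complex.ofReal_pow, hsq, sq, Finset.sum_mul_sum,
    ← Finset.sum_product']
  simp only [AddChar.map_add_eq_mul]

section Kloosterman

variable {R : Type*} [CommRing R] [Fintype R] [DecidableEq R]

/-- The points `(u, u⁻¹)` of `R × R`, with `u` running over the units of `R`. -/
def unitHyperbola (R : Type*) [CommRing R] [Fintype R] [DecidableEq R] : Finset (R × R) :=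
  {p | p.1 * p.2 = 1}

lemma mem_unitHyperbola {p : R × R} : p ∈ unitHyperbola R ↔ p.1 * p.2 = 1 := by
  simp [unitHyperbola]

lemma sum_unitHyperbola {M : Type*} [AddCommMonoid M] (f : R × R → M) :
    ∑ p ∈ unitHyperbola R, f p = ∑ u : Rˣ, f (u, ↑u⁻¹) := by
  symm
  refine Finset.sum_bij (fun u _ => (↑u, ↑u⁻¹)) (fun u _ => mem_unitHyperbola.2 u.mul_inv)
    (fun u _ v _ huv => Units.ext (Prod.ext_iff.1 huv).1) (fun p hp => ?_) (fun _ _ => rfl)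
  have hp' := mem_unitHyperbola.1 hp
  exact ⟨⟨p.1, p.2, hp', by rw [mul_comm, hp']⟩, Finset.mem_univ _, rfl⟩

/-- The Kloosterman sum `∑ ψ (m u + n u⁻¹)` over the units `u` of a finite commutative ring. -/
def kloosterman (ψ : AddChar R ℂ) (m n : R) : ℂ :=
  ∑ p ∈ unitHyperbola R, ψ (m * p.1 + n * p.2)

lemma kloosterman_comm (ψ : AddChar R ℂ) (m n : R) :
    kloosterman ψ m n = kloosterman ψ n m := by
  refine Finset.sum_bij (fun p _ => p.swap) (fun p hp => ?_)
    (fun _ _ _ _ h => Prod.swap_injective h) (fun p hp => ⟨p.swap, ?_, p.swap_swap⟩)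
    (fun p _ => ?_)
  · simpa [mem_unitHyperbola, mul_comm] using hp
  · simpa [mem_unitHyperbola, mul_comm] using hp
  · rw [Prod.fst_swap, Prod.snd_swap, add_comm]

lemma kloosterman_mul_unit (ψ : AddChar R ℂ) (m n : R) (v : Rˣ) :
    kloosterman ψ (m * v) (n * ↑v⁻¹) = kloosterman ψ m n := by
  simp only [kloosterman, sum_unitHyperbola]
  refine Fintype.sum_equiv (Equiv.mulLeft v) _ _ fun u => ?_
  simp only [Equiv.coe_mulLeft, mul_inv, Units.val_mul, mul_assoc]

lemma sum_addChar_mul_add_mul {ψ : AddChar R ℂ} (hψ : ψ.IsPrimitive) (v : R × R) :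
    ∑ m : R, ∑ n : R, ψ (m * v.1 + n * v.2) = if v = 0 then (Fintype.card R : ℂ) ^ 2 else 0 := by
  simp only [AddChar.map_add_eq_mul, ← Finset.sum_mul_sum, AddChar.sum_mulShift _ hψ,
    Prod.ext_iff, Prod.fst_zero, Prod.snd_zero]
  split_ifs <;> simp_all [sq]

lemma sum_norm_sum_addChar_pow_four {ψ : AddChar R ℂ} (hψ : ψ.IsPrimitive)
    (s : Finset (R × R)) :
    ∑ m : R, ∑ n : R, ‖∑ p ∈ s, ψ (m * p.1 + n * p.2)‖ ^ 4 =
      (Fintype.card R : ℝ) ^ 2 * E[s] := by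
  have hexpand : ∀ m n : R, ((‖∑ p ∈ s, ψ (m * p.1 + n * p.2)‖ ^ 4 : ℝ) : ℂ) =
      ∑ t ∈ (s ×ˢ s) ×ˢ s ×ˢ s, ψ (m * (t.1.1 - t.1.2 + (t.2.1 - t.2.2)).1 +
        n * (t.1.1 - t.1.2 + (t.2.1 - t.2.2)).2) := fun m n => by
    rw [norm_sum_addChar_pow_four]
    refine Finset.sum_congr rfl fun t _ => congrArg ψ ?_
    simp only [Prod.fst_add, Prod.snd_add, Prod.fst_sub, Prod.snd_sub]
    ring
  apply Complex.ofReal_injective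
  calc ((∑ m : R, ∑ n : R, ‖∑ p ∈ s, ψ (m * p.1 + n * p.2)‖ ^ 4 : ℝ) : ℂ)
      = ∑ t ∈ (s ×ˢ s) ×ˢ s ×ˢ s, ∑ m : R, ∑ n : R,
          ψ (m * (t.1.1 - t.1.2 + (t.2.1 - t.2.2)).1 +
            n * (t.1.1 - t.1.2 + (t.2.1 - t.2.2)).2) := by
        simp_rw [Complex.ofReal_sum, hexpand, Finset.sum_comm (t := (s ×ˢ s) ×ˢ s ×ˢ s)]
    _ = ∑ t ∈ (s ×ˢ s) ×ˢ s ×ˢ s,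
          if t.1.1 + t.2.1 = t.1.2 + t.2.2 then (Fintype.card R : ℂ) ^ 2 else 0 := by
        simp_rw [sum_addChar_mul_add_mul hψ, sub_add_sub_comm, sub_eq_zero]
    _ = (((Fintype.card R : ℝ) ^ 2 * E[s] : ℝ) : ℂ) := by
        rw [← Finset.sum_filter, Finset.sum_const, nsmul_eq_mul, mul_comm]
        push_cast
        rfl

/-- With `x = a - c` and `y = a - d`, a quadruple of units with `a + b = c + d` and
`a⁻¹ + b⁻¹ = c⁻¹ + d⁻¹` solves the linear equation `2 x y a = (x + y) x y`. -/
lemma two_mul_sub_mul_sub_mul_of_mem_unitHyperbola {a b c d : R × R} (ha : a ∈ unitHyperbola R)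
    (hb : b ∈ unitHyperbola R) (hc : c ∈ unitHyperbola R) (hd : d ∈ unitHyperbola R)
    (h : a + b = c + d) :
    2 * ((a.1 - c.1) * (a.1 - d.1)) * a.1 =
      (a.1 - c.1 + (a.1 - d.1)) * ((a.1 - c.1) * (a.1 - d.1)) := by
  rw [mem_unitHyperbola] at ha hb hc hd
  have hsum : a.1 + b.1 = c.1 + d.1 := congrArg Prod.fst h
  have hinv : a.2 + b.2 = c.2 + d.2 := congrArg Prod.snd h
  have hcross : (a.1 + b.1) * (c.1 * d.1) = (c.1 + d.1) * (a.1 * b.1) := by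
    linear_combination (a.1 * b.1 * c.1 * d.1) * hinv - (b.1 * c.1 * d.1) * ha -
      (a.1 * c.1 * d.1) * hb + (a.1 * b.1 * d.1) * hc + (a.1 * b.1 * c.1) * hd
  rw [eq_sub_of_add_eq' hsum] at hcross
  linear_combination hcross

lemma eq_of_mem_unitHyperbola_of_fst_eq {p p' : R × R} (hp : p ∈ unitHyperbola R)
    (hp' : p' ∈ unitHyperbola R) (h : p.1 = p'.1) : p = p' := by
  rw [mem_unitHyperbola] at hp hp'
  refine Prod.ext h ?_
  linear_combination p.2 * (-hp') + p'.2 * hp + p.2 * p'.2 * (-h)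

lemma addEnergy_unitHyperbola_le :
    E[unitHyperbola R] ≤ annihilatorCard (2 : R) * (∑ x : R, annihilatorCard x) ^ 2 := by
  set quadruples := {t ∈ (unitHyperbola R ×ˢ unitHyperbola R) ×ˢ unitHyperbola R ×ˢ
    unitHyperbola R | t.1.1 + t.2.1 = t.1.2 + t.2.2} with hquadruples
  have hmem : ∀ t ∈ quadruples, (t.1.1 ∈ unitHyperbola R ∧ t.1.2 ∈ unitHyperbola R) ∧
      (t.2.1 ∈ unitHyperbola R ∧ t.2.2 ∈ unitHyperbola R) ∧ t.1.1 + t.2.1 = t.1.2 + t.2.2 :=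
    fun t ht => by simpa [hquadruples, and_assoc] using ht
  have hfiber : ∀ p : R × R,
      #{t ∈ quadruples | (t.1.1.1 - t.1.2.1, t.1.1.1 - t.2.2.1) = p} ≤
        #{z : R | 2 * (p.1 * p.2) * z = (p.1 + p.2) * (p.1 * p.2)} := by
    intro p
    refine Finset.card_le_card_of_injOn (fun t => t.1.1.1) (fun t ht => ?_) fun t ht t' ht' h => ?_
    · obtain ⟨htmem, rfl⟩ := Finset.mem_filter.1 ht
      obtain ⟨⟨ha, hc⟩, ⟨hb, hd⟩, hsum⟩ := hmem t htmem
      simpa using two_mul_sub_mul_sub_mul_of_mem_unitHyperbola ha hb hc hd hsum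
    · obtain ⟨ht, htp⟩ := Finset.mem_filter.1 ht
      obtain ⟨ht', htp'⟩ := Finset.mem_filter.1 ht'
      obtain ⟨hxc, hxd⟩ := Prod.ext_iff.1 (htp.trans htp'.symm)
      obtain ⟨⟨ha, hc⟩, ⟨-, hd⟩, hsum⟩ := hmem t ht
      obtain ⟨⟨ha', hc'⟩, ⟨-, hd'⟩, hsum'⟩ := hmem t' ht'
      have hac : t.1.1 = t'.1.1 := eq_of_mem_unitHyperbola_of_fst_eq ha ha' h
      have hcc : t.1.2 = t'.1.2 := eq_of_mem_unitHyperbola_of_fst_eq hc hc'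
        (by linear_combination h - hxc)
      have hdd : t.2.2 = t'.2.2 := eq_of_mem_unitHyperbola_of_fst_eq hd hd'
        (by linear_combination h - hxd)
      have hbb : t.2.1 = t'.2.1 := by
        rw [eq_sub_of_add_eq' hsum, eq_sub_of_add_eq' hsum', hac, hcc, hdd]
      exact Prod.ext (Prod.ext hac hcc) (Prod.ext hbb hdd)
  calc #quadruples
      = ∑ p : R × R, #{t ∈ quadruples | (t.1.1.1 - t.1.2.1, t.1.1.1 - t.2.2.1) = p} :=
        Finset.card_eq_sum_card_fiberwise fun _ _ => Finset.mem_coe.2 (Finset.mem_univ _)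
    _ ≤ ∑ p : R × R, annihilatorCard (2 : R) * (annihilatorCard p.1 * annihilatorCard p.2) :=
        Finset.sum_le_sum fun p _ => (hfiber p).trans <|
          (card_filter_mul_eq_le_annihilatorCard _ _).trans <|
            (annihilatorCard_mul_le _ _).trans <|
              Nat.mul_le_mul_left _ (annihilatorCard_mul_le _ _)
    _ = annihilatorCard (2 : R) * (∑ x : R, annihilatorCard x) ^ 2 := by
        rw [← Finset.mul_sum, sq, Finset.sum_mul_sum, Fintype.sum_prod_type]

/-- The fourth moment contains `‖K(m, n)‖⁴` once for every unit `v`, as `‖K(m v, n v⁻¹)‖⁴`; the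
same pair `(m v, n v⁻¹)` occurs at most `annihilatorCard n` times. -/
lemma card_units_mul_norm_kloosterman_pow_four_le {ψ : AddChar R ℂ} (hψ : ψ.IsPrimitive)
    (m n : R) :
    (Fintype.card Rˣ : ℝ) * ‖kloosterman ψ m n‖ ^ 4 ≤
      annihilatorCard n * ((Fintype.card R : ℝ) ^ 2 * E[unitHyperbola R]) := by
  set moment : R × R → ℝ := fun p => ‖kloosterman ψ p.1 p.2‖ ^ 4 with hmoment
  set twist : Rˣ → R × R := fun v => (m * v, n * ↑v⁻¹) with htwist
  have hfiber : ∀ p, #{v | twist v = p} ≤ annihilatorCard n := fun p => by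
    refine le_trans (Finset.card_le_card_of_injOn (fun v : Rˣ => (↑v⁻¹ : R)) (fun v hv => ?_)
      (Units.val_injective.comp inv_injective).injOn)
      (card_filter_mul_eq_le_annihilatorCard n p.2)
    simpa using congrArg Prod.snd (Finset.mem_filter.1 hv).2
  calc (Fintype.card Rˣ : ℝ) * ‖kloosterman ψ m n‖ ^ 4
      = ∑ v : Rˣ, moment (twist v) := by
        simp only [hmoment, htwist, kloosterman_mul_unit, Finset.sum_const, Finset.card_univ,
          nsmul_eq_mul]
    _ = ∑ p, (#{v | twist v = p} : ℝ) * moment p := by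
        rw [← Finset.sum_fiberwise _ twist]
        refine Finset.sum_congr rfl fun p _ => ?_
        rw [Finset.sum_congr rfl fun v hv => congrArg moment (Finset.mem_filter.1 hv).2,
          Finset.sum_const, nsmul_eq_mul]
    _ ≤ ∑ p, (annihilatorCard n : ℝ) * moment p :=
        Finset.sum_le_sum fun p _ => by
          have := hfiber p
          gcongr
    _ = annihilatorCard n * ((Fintype.card R : ℝ) ^ 2 * E[unitHyperbola R]) := by
        rw [← Finset.mul_sum, Fintype.sum_prod_type, ← sum_norm_sum_addChar_pow_four hψ]
        rfl

end Kloosterman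

section KloostermanZMod

variable {q : ℕ} [NeZero q]

lemma annihilatorCard_natCast_le {n : ℕ} (hn : 0 < n) : annihilatorCard (n : ZMod q) ≤ n := by
  simpa only [annihilatorCard, nsmul_eq_mul] using
    IsAddCyclic.card_nsmul_eq_zero_le (α := ZMod q) hn

lemma annihilatorCard_intCast_le {n : ℤ} (hn : n ≠ 0) :
    annihilatorCard (n : ZMod q) ≤ n.natAbs := by
  have habs : annihilatorCard (n : ZMod q) = annihilatorCard ((n.natAbs : ℕ) : ZMod q) := by
    rcases abs_choice n with h | h <;> simp [annihilatorCard, h]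
  exact habs.trans_le (annihilatorCard_natCast_le (Int.natAbs_pos.2 hn))

lemma annihilatorCard_le_gcd (x : ZMod q) : annihilatorCard x ≤ Nat.gcd x.val q := by
  have hpos : 0 < Nat.gcd x.val q := Nat.gcd_pos_of_pos_right _ (NeZero.pos q)
  refine (Finset.card_le_card fun y hy => ?_).trans (annihilatorCard_natCast_le (q := q) hpos)
  have hbezout : ((Nat.gcd x.val q : ℕ) : ZMod q) = x * (Nat.gcdA x.val q : ℤ) := by
    simpa using congrArg (Int.cast : ℤ → ZMod q) (Nat.gcd_eq_gcd_ab x.val q)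
  simp only [Finset.mem_filter, Finset.mem_univ, true_and] at hy ⊢
  rw [hbezout, mul_right_comm, hy, zero_mul]

lemma card_filter_dvd_val_le {d : ℕ} (hd : d ∣ q) : #{x : ZMod q | d ∣ x.val} ≤ q / d := by
  have hpos : 0 < q / d := Nat.div_pos (Nat.le_of_dvd (NeZero.pos q) hd)
    (Nat.pos_of_dvd_of_pos hd (NeZero.pos q))
  refine (Finset.card_le_card fun x hx => ?_).trans (annihilatorCard_natCast_le (q := q) hpos)
  simp only [Finset.mem_filter, Finset.mem_univ, true_and] at hx ⊢
  rw [← ZMod.natCast_zmod_val x, ← Nat.cast_mul, ZMod.natCast_eq_zero_iff]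
  simpa only [Nat.div_mul_cancel hd] using mul_dvd_mul_left (q / d) hx

lemma sum_annihilatorCard_le : ∑ x : ZMod q, annihilatorCard x ≤ q * #q.divisors := by
  have hgcd : ∀ x : ZMod q, annihilatorCard x ≤ ∑ d ∈ q.divisors, if d ∣ x.val then d else 0 := by
    intro x
    have hmem : Nat.gcd x.val q ∈ q.divisors :=
      Nat.mem_divisors.2 ⟨Nat.gcd_dvd_right _ _, NeZero.ne q⟩
    calc annihilatorCard x ≤ Nat.gcd x.val q := annihilatorCard_le_gcd x
      _ = if Nat.gcd x.val q ∣ x.val then Nat.gcd x.val q else 0 :=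
          (if_pos (Nat.gcd_dvd_left _ _)).symm
      _ ≤ ∑ d ∈ q.divisors, if d ∣ x.val then d else 0 :=
          Finset.single_le_sum (f := fun d => if d ∣ x.val then d else 0)
            (fun _ _ => Nat.zero_le _) hmem
  calc ∑ x : ZMod q, annihilatorCard x
      ≤ ∑ x : ZMod q, ∑ d ∈ q.divisors, (if d ∣ x.val then d else 0) :=
        Finset.sum_le_sum fun x _ => hgcd x
    _ = ∑ d ∈ q.divisors, #{x : ZMod q | d ∣ x.val} * d := by
        rw [Finset.sum_comm]
        simp only [← Finset.sum_filter, Finset.sum_const, smul_eq_mul]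
    _ ≤ ∑ _d ∈ q.divisors, q := Finset.sum_le_sum fun _ hd => by
        have hdvd := Nat.dvd_of_mem_divisors hd
        exact (Nat.mul_le_mul_right _ (card_filter_dvd_val_le hdvd)).trans_eq
          (Nat.div_mul_cancel hdvd)
    _ = q * #q.divisors := by rw [Finset.sum_const, smul_eq_mul, mul_comm]

lemma totient_mul_norm_kloosterman_pow_four_le (m : ZMod q) {n : ℤ} (hn : n ≠ 0) :
    (q.totient : ℝ) * ‖kloosterman ZMod.stdAddChar m (n : ZMod q)‖ ^ 4 ≤
      n.natAbs * ((q : ℝ) ^ 2 * (2 * (q * #q.divisors) ^ 2)) := by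
  have hmoment := card_units_mul_norm_kloosterman_pow_four_le (ZMod.isPrimitive_stdAddChar q) m
    (n : ZMod q)
  rw [ZMod.card_units_eq_totient, ZMod.card] at hmoment
  have henergy : E[unitHyperbola (ZMod q)] ≤ 2 * (q * #q.divisors) ^ 2 :=
    addEnergy_unitHyperbola_le.trans <| Nat.mul_le_mul
      (by simpa using annihilatorCard_natCast_le (q := q) two_pos)
      (Nat.pow_le_pow_left sum_annihilatorCard_le 2)
  refine hmoment.trans ?_
  have hn' := annihilatorCard_intCast_le (q := q) hn
  gcongr
  exact_mod_cast henergy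

end KloostermanZMod

section DivisorBound

lemma le_totient_mul_card_divisors (n : ℕ) : n ≤ n.totient * #n.divisors := by
  rcases Nat.eq_zero_or_pos n with rfl | hn
  · simp
  calc n = ∑ d ∈ n.divisors, d.totient := (Nat.sum_totient n).symm
    _ ≤ ∑ _d ∈ n.divisors, n.totient := Finset.sum_le_sum fun _ hd =>
        Nat.le_of_dvd (Nat.totient_pos.2 hn)
          (Nat.totient_dvd_of_dvd (Nat.dvd_of_mem_divisors hd))
    _ = n.totient * #n.divisors := by rw [Finset.sum_const, smul_eq_mul, mul_comm]

lemma exists_succ_pow_le_mul_two_pow (K : ℕ) :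
    ∃ M : ℕ, 1 ≤ M ∧ ∀ k : ℕ, (k + 1) ^ K ≤ M * 2 ^ k := by
  obtain ⟨B, hB⟩ :=
    (tendsto_pow_const_div_const_pow_of_one_lt K (one_lt_two (α := ℝ))).bddAbove_range
  obtain ⟨M, hM⟩ := exists_nat_ge (max (2 * B) 1)
  refine ⟨M, by exact_mod_cast (le_max_right _ _).trans hM, fun k => ?_⟩
  have hk : ((k + 1 : ℕ) : ℝ) ^ K / 2 ^ (k + 1) ≤ B := hB ⟨k + 1, rfl⟩
  rw [div_le_iff₀ (by positivity)] at hk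
  have : ((k + 1 : ℕ) : ℝ) ^ K ≤ M * 2 ^ k :=
    calc ((k + 1 : ℕ) : ℝ) ^ K ≤ B * 2 ^ (k + 1) := hk
      _ = (2 * B) * 2 ^ k := by ring
      _ ≤ M * 2 ^ k := by gcongr; exact (le_max_left _ _).trans hM
  exact_mod_cast this

/-- In `τ(n) ^ K = ∏ (v_p(n) + 1) ^ K` a prime `p ≥ 2 ^ K` contributes at most `p ^ v_p(n)`; each of
the boundedly many smaller primes costs one more constant factor. -/
lemma exists_card_divisors_pow_le (K : ℕ) :
    ∃ C : ℕ, ∀ n : ℕ, n ≠ 0 → #n.divisors ^ K ≤ C * n := by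
  obtain ⟨M, hM_one, hM⟩ := exists_succ_pow_le_mul_two_pow K
  refine ⟨M ^ (2 ^ K), fun n hn => ?_⟩
  have hfactor : ∀ p ∈ n.primeFactors, (n.factorization p + 1) ^ K ≤
      (if p < 2 ^ K then M else 1) * p ^ n.factorization p := fun p hp => by
    have htwo : 2 ≤ p := (Nat.prime_of_mem_primeFactors hp).two_le
    split_ifs with hsmall
    · exact (hM _).trans (Nat.mul_le_mul_left _ (Nat.pow_le_pow_left htwo _))
    · calc (n.factorization p + 1) ^ K ≤ (2 ^ n.factorization p) ^ K :=
            Nat.pow_le_pow_left Nat.lt_two_pow_self _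
        _ = (2 ^ K) ^ n.factorization p := pow_right_comm _ _ _
        _ ≤ p ^ n.factorization p := Nat.pow_le_pow_left (not_lt.1 hsmall) _
        _ = 1 * p ^ n.factorization p := (one_mul _).symm
  have hsmall_card : #{p ∈ n.primeFactors | p < 2 ^ K} ≤ 2 ^ K :=
    calc #{p ∈ n.primeFactors | p < 2 ^ K} ≤ #(Finset.range (2 ^ K)) :=
          Finset.card_le_card fun p hp => by simpa using (Finset.mem_filter.1 hp).2
      _ = 2 ^ K := Finset.card_range _
  calc #n.divisors ^ K = ∏ p ∈ n.primeFactors, (n.factorization p + 1) ^ K := by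
        rw [Nat.card_divisors hn, ← Finset.prod_pow]
    _ ≤ ∏ p ∈ n.primeFactors, (if p < 2 ^ K then M else 1) * p ^ n.factorization p :=
        Finset.prod_le_prod' hfactor
    _ = M ^ #{p ∈ n.primeFactors | p < 2 ^ K} * n := by
        rw [Finset.prod_mul_distrib, Finset.prod_ite, Finset.prod_const, Finset.prod_const_one,
          mul_one]
        congr 1
        exact Nat.prod_factorization_pow_eq_self hn
    _ ≤ M ^ (2 ^ K) * n :=
        Nat.mul_le_mul_right _ (Nat.pow_le_pow_right hM_one hsmall_card)

lemma tendsto_card_divisors_pow_div (K : ℕ) :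
    Tendsto (fun n : ℕ => (#n.divisors : ℝ) ^ K / n) atTop (𝓝 0) := by
  obtain ⟨C, hC⟩ := exists_card_divisors_pow_le (K * 2)
  have hmajorant : Tendsto (fun n : ℕ => √C / √(n : ℝ)) atTop (𝓝 0) :=
    (Real.tendsto_sqrt_atTop.comp tendsto_natCast_atTop_atTop).const_div_atTop _
  refine squeeze_zero' (Eventually.of_forall fun n => by positivity) ?_ hmajorant
  filter_upwards [eventually_ne_atTop 0] with n hn
  have hsq : ((#n.divisors : ℝ) ^ K) ^ 2 ≤ C * n := by
    rw [← pow_mul]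
    exact_mod_cast hC n hn
  have hn' : (0 : ℝ) < √n := Real.sqrt_pos.2 (by positivity)
  calc (#n.divisors : ℝ) ^ K / n ≤ √(C * n) / n := by gcongr; exact Real.le_sqrt_of_sq_le hsq
    _ = √C * √n / (√n * √n) := by
        rw [Real.sqrt_mul (Nat.cast_nonneg _), Real.mul_self_sqrt (Nat.cast_nonneg _)]
    _ = √C / √n := mul_div_mul_right _ _ hn'.ne'

end DivisorBound

section KloostermanDecay

lemma norm_kloosterman_div_totient_pow_four_le {q : ℕ} [NeZero q] (m : ZMod q) {n : ℤ}
    (hn : n ≠ 0) :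
    ‖kloosterman ZMod.stdAddChar m (n : ZMod q) / (q.totient : ℂ)‖ ^ 4 ≤
      2 * n.natAbs * ((#q.divisors : ℝ) ^ 7 / q) := by
  have hq : (0 : ℝ) < q := by exact_mod_cast NeZero.pos q
  have hφ : (0 : ℝ) < q.totient := by exact_mod_cast Nat.totient_pos.2 (NeZero.pos q)
  have hqφ : (q : ℝ) ≤ q.totient * #q.divisors := by exact_mod_cast le_totient_mul_card_divisors q
  rw [norm_div, div_pow, Complex.norm_natCast, div_le_iff₀ (by positivity), mul_div_assoc',
    div_mul_eq_mul_div, le_div_iff₀ hq]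
  refine le_of_mul_le_mul_left ?_ hφ
  calc (q.totient : ℝ) * (‖kloosterman ZMod.stdAddChar m (n : ZMod q)‖ ^ 4 * q)
      = q.totient * ‖kloosterman ZMod.stdAddChar m (n : ZMod q)‖ ^ 4 * q := by ring
    _ ≤ n.natAbs * ((q : ℝ) ^ 2 * (2 * (q * #q.divisors) ^ 2)) * q :=
        mul_le_mul_of_nonneg_right (totient_mul_norm_kloosterman_pow_four_le m hn) hq.le
    _ = 2 * n.natAbs * (#q.divisors : ℝ) ^ 2 * (q : ℝ) ^ 5 := by ring
    _ ≤ 2 * n.natAbs * (#q.divisors : ℝ) ^ 2 * (q.totient * #q.divisors) ^ 5 := by gcongr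
    _ = q.totient * (2 * n.natAbs * (#q.divisors : ℝ) ^ 7 * (q.totient : ℝ) ^ 4) := by ring

lemma tendsto_kloosterman_div_totient {m n : ℤ} (h : m ≠ 0 ∨ n ≠ 0) :
    Tendsto (fun q : ℕ => kloosterman ZMod.stdAddChar (m : ZMod (q + 1)) (n : ZMod (q + 1)) /
      ((q + 1).totient : ℂ)) atTop (𝓝 0) := by
  wlog hn : n ≠ 0 generalizing m n
  · simp_rw [fun q : ℕ => kloosterman_comm ZMod.stdAddChar (m : ZMod (q + 1)) (n : ZMod (q + 1))]
    exact this h.symm (h.resolve_right hn)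
  have hmajorant : Tendsto (fun q : ℕ => 2 * (n.natAbs : ℝ) *
      ((#(q + 1).divisors : ℝ) ^ 7 / (q + 1 : ℕ))) atTop (𝓝 0) := by
    simpa using ((tendsto_add_atTop_iff_nat 1).2
      (tendsto_card_divisors_pow_div 7)).const_mul (2 * (n.natAbs : ℝ))
  have hpow : Tendsto (fun q : ℕ => ‖kloosterman ZMod.stdAddChar (m : ZMod (q + 1))
      (n : ZMod (q + 1)) / ((q + 1).totient : ℂ)‖ ^ 4) atTop (𝓝 0) :=
    squeeze_zero (fun q => by positivity)
      (fun q => norm_kloosterman_div_totient_pow_four_le (q := q + 1) _ hn) hmajorant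
  rw [tendsto_zero_iff_norm_tendsto_zero]
  have hroot := hpow.rpow_const (p := (4 : ℝ)⁻¹) (Or.inr (by norm_num))
  rw [Real.zero_rpow (by norm_num)] at hroot
  exact hroot.congr fun q => by
    simpa using Real.pow_rpow_inv_natCast (norm_nonneg (kloosterman ZMod.stdAddChar
      (m : ZMod (q + 1)) (n : ZMod (q + 1)) / ((q + 1).totient : ℂ))) four_ne_zero

end KloostermanDecay

section WeylCriterion

instance : IsProbabilityMeasure (volume : Measure UnitAddCircle) :=
  ⟨UnitAddCircle.measure_univ⟩

variable {d : Type*} [Fintype d]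

lemma integral_mFourier_eq_zero {k : d → ℤ} (hk : k ≠ 0) :
    ∫ x, UnitAddTorus.mFourier k x = 0 := by
  obtain ⟨i, hi⟩ := Function.ne_iff.1 hk
  have hzero : ∫ x : UnitAddCircle, (fourier (k i) x : ℂ) = 0 :=
    integral_eq_zero_of_add_right_eq_neg (fourier_add_half_inv_index hi one_pos)
  simp only [UnitAddTorus.mFourier, ContinuousMap.coe_mk, volume_pi]
  rw [integral_fintype_prod_eq_prod (fun i (x : UnitAddCircle) => (fourier (k i) x : ℂ))]
  exact Finset.prod_eq_zero (Finset.mem_univ i) hzero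

theorem tendsto_of_tendsto_integral_mFourier {ι : Type*} {l : Filter ι}
    {μs : ι → ProbabilityMeasure (UnitAddTorus d)} {μ : ProbabilityMeasure (UnitAddTorus d)}
    (h : ∀ k : d → ℤ, Tendsto (fun i => ∫ x, UnitAddTorus.mFourier k x ∂(μs i)) l
      (𝓝 (∫ x, UnitAddTorus.mFourier k x ∂μ))) :
    Tendsto μs l (𝓝 μ) := by
  have hint : ∀ (g : C(UnitAddTorus d, ℂ)) (ν : ProbabilityMeasure (UnitAddTorus d)),
      Integrable g (ν : Measure (UnitAddTorus d)) := fun g ν =>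
    BoundedContinuousFunction.integrable _ (BoundedContinuousFunction.mkOfCompact g)
  have hspan : ∀ g ∈ Submodule.span ℂ (range (UnitAddTorus.mFourier (d := d))),
      Tendsto (fun i => ∫ x, g x ∂(μs i)) l (𝓝 (∫ x, g x ∂μ)) := by
    intro g hg
    induction hg using Submodule.span_induction with
    | mem g hg => obtain ⟨k, rfl⟩ := hg; exact h k
    | zero => simpa using tendsto_const_nhds
    | add f g _ _ hf hg => simpa [integral_add (hint _ _) (hint _ _)] using hf.add hg
    | smul c g _ hg => simpa [integral_const_mul] using hg.const_mul c
  refine ProbabilityMeasure.tendsto_of_tight_of_separatesPoints ℂ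
    IsTightMeasureSet.of_compactSpace
    (A := (UnitAddTorus.mFourierSubalgebra d).comap
      (BoundedContinuousFunction.toContinuousMapStarₐ ℂ)) ?_ fun g hg => ?_
  · intro x y hxy
    obtain ⟨-, ⟨f, hf, rfl⟩, hfxy⟩ := UnitAddTorus.mFourierSubalgebra_separatesPoints (d := d) hxy
    exact ⟨f, ⟨f, ⟨BoundedContinuousFunction.mkOfCompact f, hf, rfl⟩, rfl⟩, hfxy⟩
  · refine hspan g.toContinuousMap ?_
    rw [← UnitAddTorus.mFourierSubalgebra_coe]
    exact hg

end WeylCriterion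

section EmpiricalMeasure

variable {ι E : Type*} [Fintype ι] [MeasurableSpace E]

/-- The uniform probability measure on a finite non-empty family of points, counted with
multiplicity. -/
def empiricalMeasure (x : ι → E) : Measure E :=
  (Fintype.card ι : ENNReal)⁻¹ • ∑ i, Measure.dirac (x i)

instance [Nonempty ι] (x : ι → E) : IsProbabilityMeasure (empiricalMeasure x) := by
  constructor
  simp only [empiricalMeasure, Measure.smul_apply, Measure.coe_finsetSum, Finset.sum_apply,
    measure_univ, Finset.sum_const, Finset.card_univ, nsmul_eq_mul, mul_one, smul_eq_mul]
  exact ENNReal.inv_mul_cancel (by simp) (by simp)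

lemma empiricalMeasure_real_apply [MeasurableSingletonClass E] (x : ι → E) (A : Set E) :
    (empiricalMeasure x).real A = {i | x i ∈ A}.ncard / Fintype.card ι := by
  classical
  simp only [Measure.real, empiricalMeasure, Measure.smul_apply, Measure.coe_finsetSum,
    Finset.sum_apply, smul_eq_mul, Measure.dirac_apply, indicator_apply, Pi.one_apply,
    Finset.sum_boole, ENNReal.toReal_mul, ENNReal.toReal_inv, ENNReal.toReal_natCast]
  rw [div_eq_inv_mul, Set.ncard_eq_toFinset_card']
  simp

lemma integral_empiricalMeasure [MeasurableSingletonClass E] (x : ι → E) (f : E → ℂ) :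
    ∫ y, f y ∂(empiricalMeasure x) = (∑ i, f (x i)) / Fintype.card ι := by
  rw [empiricalMeasure, integral_smul_measure, integral_finsetSum_measure
    fun i _ => integrable_dirac (by simp)]
  simp [integral_dirac, div_eq_inv_mul]

end EmpiricalMeasure

section InversePoints

/-- The point `(u / q, -u⁻¹ / q)` of the torus. -/
def inversePoint {q : ℕ} [NeZero q] (u : (ZMod q)ˣ) : UnitAddTorus (Fin 2) :=
  ![ZMod.toAddCircle (u : ZMod q), ZMod.toAddCircle (-((u⁻¹ : (ZMod q)ˣ) : ZMod q))]

lemma mFourier_inversePoint {q : ℕ} [NeZero q] (k : Fin 2 → ℤ) (u : (ZMod q)ˣ) :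
    UnitAddTorus.mFourier k (inversePoint u) =
      ZMod.stdAddChar ((k 0 : ZMod q) * (u : ZMod q) +
        ((-k 1 : ℤ) : ZMod q) * ((u⁻¹ : (ZMod q)ˣ) : ZMod q)) := by
  simp only [UnitAddTorus.mFourier, ContinuousMap.coe_mk, Fin.prod_univ_two, inversePoint,
    Matrix.cons_val_zero, Matrix.cons_val_one, fourier_apply, AddChar.map_add_eq_mul,
    ZMod.stdAddChar_apply, ZMod.toCircle, AddChar.coe_compAddMonoidHom, Function.comp_apply,
    ← map_zsmul, zsmul_eq_mul, Int.cast_neg, neg_mul, mul_neg]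
  rfl

lemma integral_mFourier_inversePoint (q : ℕ) [NeZero q] (k : Fin 2 → ℤ) :
    ∫ x, UnitAddTorus.mFourier k x ∂(empiricalMeasure (inversePoint (q := q))) =
      kloosterman ZMod.stdAddChar (k 0 : ZMod q) ((-k 1 : ℤ) : ZMod q) / (q.totient : ℂ) := by
  rw [integral_empiricalMeasure, ZMod.card_units_eq_totient, kloosterman, sum_unitHyperbola]
  simp only [mFourier_inversePoint]

lemma tendsto_ncard_inversePoint_mem {A : Set (UnitAddTorus (Fin 2))}
    (hA : volume (frontier A) = 0) :
    Tendsto (fun q : ℕ => ({u : (ZMod (q + 1))ˣ | inversePoint u ∈ A}.ncard : ℝ) /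
      ((q + 1).totient : ℝ)) atTop (𝓝 (volume.real A)) := by
  set μs : ℕ → ProbabilityMeasure (UnitAddTorus (Fin 2)) := fun q =>
    ⟨empiricalMeasure (inversePoint (q := q + 1)), inferInstance⟩ with hμs
  have hweak : Tendsto μs atTop (𝓝 ⟨volume, inferInstance⟩) := by
    refine tendsto_of_tendsto_integral_mFourier fun k => ?_
    simp only [hμs, ProbabilityMeasure.coe_mk]
    rcases eq_or_ne k 0 with rfl | hk
    · simp [UnitAddTorus.mFourier_zero]
    · simp_rw [integral_mFourier_eq_zero hk, integral_mFourier_inversePoint]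
      refine tendsto_kloosterman_div_totient ?_
      by_contra! h
      exact hk (by ext i; fin_cases i <;> simp_all)
  have hmeasure := (ENNReal.tendsto_toReal (measure_ne_top volume A)).comp
    (ProbabilityMeasure.tendsto_measure_of_null_frontier_of_tendsto' hweak hA)
  refine hmeasure.congr fun q => ?_
  rw [← ZMod.card_units_eq_totient]
  exact empiricalMeasure_real_apply _ _

end InversePoints

section Arc

/-- The arc `[0, c)` of the circle. -/
def arc (c : ℝ) : Set UnitAddCircle := (fun x : ℝ => (x : UnitAddCircle)) '' Ico 0 c

lemma coe_mem_arc {c : ℝ} (hc : c ≤ 1) {x : ℝ} (hx : x ∈ Ico (0 : ℝ) 1) :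
    (x : UnitAddCircle) ∈ arc c ↔ x < c := by
  refine ⟨?_, fun h => ⟨x, ⟨hx.1, h⟩, rfl⟩⟩
  rintro ⟨y, hy, hxy⟩
  have hyx : y = x := (AddCircle.coe_eq_coe_iff_of_mem_Ico (p := (1 : ℝ)) (a := 0)
    (by simpa using ⟨hy.1, hy.2.trans_le hc⟩) (by simpa using hx)).1 hxy
  exact hyx ▸ hy.2

lemma volume_frontier_arc (c : ℝ) : volume (frontier (arc c)) = 0 := by
  have hclosure : closure (arc c) ⊆ (fun x : ℝ => (x : UnitAddCircle)) '' Icc 0 c :=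
    closure_minimal (image_mono Ico_subset_Icc_self)
      (isCompact_Icc.image (AddCircle.continuous_mk' (1 : ℝ))).isClosed
  have hinterior : (fun x : ℝ => (x : UnitAddCircle)) '' Ioo 0 c ⊆ interior (arc c) :=
    interior_maximal (image_mono Ioo_subset_Ico_self)
      (QuotientAddGroup.isOpenMap_coe _ isOpen_Ioo)
  have hfrontier : frontier (arc c) ⊆ {((0 : ℝ) : UnitAddCircle), (c : UnitAddCircle)} := by
    rintro x ⟨hx, hx'⟩
    obtain ⟨y, hy, rfl⟩ := hclosure hx
    rcases eq_or_lt_of_le hy.1 with rfl | hy₀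
    · exact Or.inl rfl
    rcases eq_or_lt_of_le hy.2 with rfl | hyc
    · exact Or.inr rfl
    exact absurd (hinterior ⟨y, ⟨hy₀, hyc⟩, rfl⟩) hx'
  have hsingleton : ∀ x : UnitAddCircle, volume {x} = 0 := fun x => by
    rw [← Metric.closedBall_zero, AddCircle.volume_closedBall]
    simp
  exact measure_mono_null hfrontier
    (measure_union_null (hsingleton _) (hsingleton _))

lemma volume_arc {c : ℝ} (hc : c ≤ 1) : volume (arc c) = ENNReal.ofReal c := by
  have hpreimage : (fun x : ℝ => (x : UnitAddCircle)) ⁻¹' arc c ∩ Ioo 0 1 = Ioo 0 c := by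
    ext x
    refine ⟨fun ⟨hxc, hx⟩ => ⟨hx.1, (coe_mem_arc hc ⟨hx.1.le, hx.2⟩).1 hxc⟩, fun hx => ?_⟩
    exact ⟨⟨x, ⟨hx.1.le, hx.2⟩, rfl⟩, hx.1, hx.2.trans_le hc⟩
  rw [← (UnitAddCircle.measurePreserving_mk 0).measure_preimage
      (nullMeasurableSet_of_null_frontier (volume_frontier_arc c)),
    zero_add, ← Measure.restrict_congr_set Ioo_ae_eq_Ioc,
    Measure.restrict_apply' measurableSet_Ioo, hpreimage, Real.volume_Ioo, sub_zero]

lemma tendsto_ncard_mem_arc {D : Set UnitAddCircle} (hD : volume (frontier D) = 0)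
    {c : ℝ} (hc₀ : 0 ≤ c) (hc : c ≤ 1) :
    Tendsto (fun q : ℕ => ({u : (ZMod (q + 1))ˣ | ZMod.toAddCircle (u : ZMod (q + 1)) ∈ arc c ∧
      ZMod.toAddCircle (-((u⁻¹ : (ZMod (q + 1))ˣ) : ZMod (q + 1))) ∈ D}.ncard : ℝ) /
      ((q + 1).totient : ℝ)) atTop (𝓝 (volume.real D * c)) := by
  set A : Set (UnitAddTorus (Fin 2)) := Set.pi univ ![arc c, D] with hA
  have hinter : A = (Function.eval 0 : UnitAddTorus (Fin 2) → UnitAddCircle) ⁻¹' arc c ∩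
      (Function.eval 1 : UnitAddTorus (Fin 2) → UnitAddCircle) ⁻¹' D := by
    ext x
    simp [hA, Fin.forall_fin_two]
  have hpreimage : ∀ (i : Fin 2) (s : Set UnitAddCircle), volume (frontier s) = 0 →
      volume (frontier ((Function.eval i : UnitAddTorus (Fin 2) → UnitAddCircle) ⁻¹' s)) = 0 := by
    intro i s hs
    rw [← (isOpenMap_eval i).preimage_frontier_eq_frontier_preimage (continuous_apply i)]
    exact (Measure.quasiMeasurePreserving_eval (fun _ : Fin 2 => (volume : Measure UnitAddCircle))
      i).preimage_null hs
  have hfrontier : volume (frontier A) = 0 := by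
    rw [hinter]
    exact null_frontier_inter (hpreimage 0 _ (volume_frontier_arc c)) (hpreimage 1 _ hD)
  have hvolume : volume.real A = volume.real D * c := by
    rw [Measure.real, hA, volume_pi, Measure.pi_pi, Fin.prod_univ_two]
    simp [volume_arc hc, hc₀, Measure.real, mul_comm]
  rw [← hvolume]
  refine (tendsto_ncard_inversePoint_mem hfrontier).congr fun q => ?_
  simp [hinter, inversePoint]

end Arc

section Monotone

/-- Squeeze `F i y` between the values of `F i` at the endpoints of a small interval around `y`. -/
theorem tendstoLocallyUniformly_of_monotone {α ι : Type*} [LinearOrder α] [TopologicalSpace α]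
    [OrderTopology α] {l : Filter ι} {F : ι → α → ℝ} {f : α → ℝ} (hF : ∀ i, Monotone (F i))
    (hf : Continuous f) (hlim : ∀ x, Tendsto (fun i => F i x) l (𝓝 (f x))) :
    TendstoLocallyUniformly F f l := by
  rw [Metric.tendstoLocallyUniformly_iff]
  intro ε hε x
  obtain ⟨a, b, hx, hnhds, hsub⟩ := exists_Icc_mem_subset_of_mem_nhds
    (hf.continuousAt.preimage_mem_nhds (Metric.ball_mem_nhds (f x) (by positivity : 0 < ε / 3)))
  have hab : a ≤ b := hx.1.trans hx.2
  refine ⟨Icc a b, hnhds, ?_⟩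
  filter_upwards [Metric.tendsto_nhds.1 (hlim a) (ε / 3) (by positivity),
    Metric.tendsto_nhds.1 (hlim b) (ε / 3) (by positivity)] with i ha hb y hy
  have hfa : |f a - f x| < ε / 3 := hsub (left_mem_Icc.2 hab)
  have hfb : |f b - f x| < ε / 3 := hsub (right_mem_Icc.2 hab)
  have hfy : |f y - f x| < ε / 3 := hsub hy
  have hFa := hF i hy.1
  have hFb := hF i hy.2
  rw [Real.dist_eq, abs_lt] at ha hb ⊢
  rw [abs_lt] at hfa hfb hfy
  constructor <;> linarith

end Monotone

section NeighbourCount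

/-- The fraction `a / q ∈ [0, 1)` with `a n ≡ -1` modulo `q`. If `n` is coprime to `q`, then
`Q - q < n ≤ Q` makes it the Farey point of level `Q` whose right neighbour has denominator `n`. -/
def leftNeighbour (q n : ℕ) : ℝ := ((-(n : ZMod q)⁻¹).val : ℝ) / q

/-- `n` is coprime to `q` and the point `leftNeighbour q n` of the circle lies in `D`. -/
def LeftNeighbourMem (D : Set UnitAddCircle) (q n : ℕ) : Prop :=
  n.Coprime q ∧ (leftNeighbour q n : UnitAddCircle) ∈ D

open Classical in
/-- The number of `n < N` with `LeftNeighbourMem D q n`. -/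
def neighbourCount (D : Set UnitAddCircle) (q N : ℕ) : ℕ := Nat.count (LeftNeighbourMem D q) N

variable {D : Set UnitAddCircle} {q : ℕ}

lemma leftNeighbourMem_add_self (n : ℕ) :
    LeftNeighbourMem D q (q + n) ↔ LeftNeighbourMem D q n := by
  simp [LeftNeighbourMem, leftNeighbour]

lemma leftNeighbourMem_val_unit [NeZero q] (u : (ZMod q)ˣ) :
    LeftNeighbourMem D q (u : ZMod q).val ↔
      ZMod.toAddCircle (-((u⁻¹ : (ZMod q)ˣ) : ZMod q)) ∈ D := by
  rw [LeftNeighbourMem, leftNeighbour, ZMod.natCast_zmod_val, ZMod.inv_coe_unit,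
    ZMod.toAddCircle_apply]
  exact and_iff_right (ZMod.val_coe_unit_coprime u)

lemma neighbourCount_mono : Monotone (neighbourCount D q) := by
  classical exact Nat.count_monotone _

lemma neighbourCount_mul_add (k N : ℕ) :
    neighbourCount D q (k * q + N) = k * neighbourCount D q q + neighbourCount D q N := by
  have hperiod : ∀ m, neighbourCount D q (q + m) = neighbourCount D q q + neighbourCount D q m :=
    fun m => by
      rw [neighbourCount, Nat.count_add]
      congr 2
      ext n
      exact leftNeighbourMem_add_self n
  induction k with
  | zero => simp
  | succ k ih =>
    rw [show (k + 1) * q + N = q + (k * q + N) by ring, hperiod, ih]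
    ring

lemma neighbourCount_ceil_mul_eq_ncard [NeZero q] {c : ℝ} (hc : c ≤ 1) :
    neighbourCount D q ⌈c * q⌉₊ = {u : (ZMod q)ˣ | ZMod.toAddCircle (u : ZMod q) ∈ arc c ∧
      ZMod.toAddCircle (-((u⁻¹ : (ZMod q)ˣ) : ZMod q)) ∈ D}.ncard := by
  classical
  have hq : (0 : ℝ) < q := by exact_mod_cast NeZero.pos q
  have harc : ∀ x : ZMod q, ZMod.toAddCircle x ∈ arc c ↔ x.val < ⌈c * q⌉₊ := fun x => by
    have hx : (x.val : ℝ) / q < 1 := by rw [div_lt_one hq]; exact_mod_cast ZMod.val_lt x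
    rw [ZMod.toAddCircle_apply, coe_mem_arc hc ⟨by positivity, hx⟩, div_lt_iff₀ hq, Nat.lt_ceil]
  have hceil : ⌈c * q⌉₊ ≤ q := Nat.ceil_le.2 (mul_le_of_le_one_left hq.le hc)
  rw [neighbourCount, Nat.count_eq_card_filter_range, ← Set.ncard_coe_finset]
  symm
  refine Set.ncard_congr (fun u _ => (u : ZMod q).val) (fun u hu => ?_)
    (fun u v _ _ h => Units.ext (ZMod.val_injective q h)) fun n hn => ?_
  · rw [Finset.mem_coe, Finset.mem_filter, Finset.mem_range]
    exact ⟨(harc _).1 hu.1, (leftNeighbourMem_val_unit u).2 hu.2⟩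
  · rw [Finset.mem_coe, Finset.mem_filter, Finset.mem_range] at hn
    have hval : ((ZMod.unitOfCoprime n hn.2.1 : (ZMod q)ˣ) : ZMod q).val = n := by
      rw [ZMod.coe_unitOfCoprime, ZMod.val_cast_of_lt (hn.1.trans_le hceil)]
    refine ⟨ZMod.unitOfCoprime n hn.2.1, ⟨(harc _).2 ?_, (leftNeighbourMem_val_unit _).1 ?_⟩, hval⟩
    · rw [hval]; exact hn.1
    · rw [hval]; exact hn.2

lemma tendsto_neighbourCount_div_totient (hD : volume (frontier D) = 0) (x : ℝ) :
    Tendsto (fun q : ℕ => (neighbourCount D q ⌈x * q⌉₊ : ℝ) / q.totient) atTop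
      (𝓝 (volume.real D * max x 0)) := by
  have hunit : ∀ {c : ℝ}, 0 ≤ c → c ≤ 1 →
      Tendsto (fun q : ℕ => (neighbourCount D q ⌈c * q⌉₊ : ℝ) / q.totient) atTop
        (𝓝 (volume.real D * c)) := fun hc₀ hc => by
    refine (tendsto_add_atTop_iff_nat 1).1 ((tendsto_ncard_mem_arc hD hc₀ hc).congr fun q => ?_)
    rw [neighbourCount_ceil_mul_eq_ncard hc]
  rcases le_total x 0 with hx | hx
  · have hceil : ∀ q : ℕ, ⌈x * q⌉₊ = 0 := fun q =>
      Nat.ceil_eq_zero.2 (mul_nonpos_of_nonpos_of_nonneg hx q.cast_nonneg)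
    simp [hceil, max_eq_right hx, neighbourCount]
  rw [max_eq_left hx, show volume.real D * x =
    ⌊x⌋₊ * (volume.real D * 1) + volume.real D * Int.fract x by
      rw [mul_one, mul_comm _ (volume.real D), ← mul_add, natCast_floor_eq_intCast_floor hx,
        Int.floor_add_fract]]
  refine (((hunit zero_le_one le_rfl).const_mul (⌊x⌋₊ : ℝ)).add
    (hunit (Int.fract_nonneg x) (Int.fract_lt_one x).le)).congr fun q => ?_
  have hceil : ⌈x * q⌉₊ = ⌊x⌋₊ * q + ⌈Int.fract x * q⌉₊ := by
    rw [add_comm (⌊x⌋₊ * q), ← Nat.ceil_add_natCast (by have := Int.fract_nonneg x; positivity)]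
    conv_lhs => rw [← Int.fract_add_floor x, ← natCast_floor_eq_intCast_floor hx, add_mul]
    norm_cast
  rw [hceil, neighbourCount_mul_add, one_mul, Nat.ceil_natCast]
  push_cast
  ring

lemma eventually_abs_neighbourCount_sub_le (hD : volume (frontier D) = 0) {ε : ℝ} (hε : 0 < ε) :
    ∀ᶠ q : ℕ in atTop, ∀ N ≤ 2 * q,
      |(neighbourCount D q N : ℝ) - volume.real D * q.totient * (N / q)| ≤ ε * q.totient := by
  have hmono : ∀ q : ℕ, Monotone fun x : ℝ => (neighbourCount D q ⌈x * q⌉₊ : ℝ) / q.totient := by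
    intro q x y hxy
    dsimp only
    gcongr
    exact neighbourCount_mono (Nat.ceil_mono (by gcongr))
  have huniform := tendstoLocallyUniformlyOn_iff_tendstoUniformlyOn_of_compact isCompact_Icc |>.1
    (tendstoLocallyUniformly_of_monotone (f := fun x => volume.real D * max x 0) hmono
      (by fun_prop) (tendsto_neighbourCount_div_totient hD)
        |>.tendstoLocallyUniformlyOn (s := Icc 0 2))
  filter_upwards [Metric.tendstoUniformlyOn_iff.1 huniform ε hε, eventually_gt_atTop 0]
    with q hq hq₀ N hN
  have hq₀' : (0 : ℝ) < q := by exact_mod_cast hq₀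
  have hφ : (0 : ℝ) < q.totient := by exact_mod_cast Nat.totient_pos.2 hq₀
  have hx : (N : ℝ) / q ∈ Icc (0 : ℝ) 2 :=
    ⟨by positivity, by rw [div_le_iff₀ hq₀']; exact_mod_cast hN⟩
  have hclose := hq _ hx
  rw [max_eq_left hx.1, div_mul_cancel₀ _ hq₀'.ne', Nat.ceil_natCast, dist_comm, Real.dist_eq]
    at hclose
  calc |(neighbourCount D q N : ℝ) - volume.real D * q.totient * (N / q)|
      = |(neighbourCount D q N : ℝ) / q.totient - volume.real D * (N / q)| * q.totient := by
        rw [← abs_of_pos hφ, ← abs_mul, abs_of_pos hφ, sub_mul, div_mul_cancel₀ _ hφ.ne']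
        ring_nf
    _ ≤ ε * q.totient := by gcongr

lemma eventually_abs_neighbourCount_add_sub_le (hD : volume (frontier D) = 0) {ε : ℝ}
    (hε : 0 < ε) :
    ∀ᶠ q : ℕ in atTop, ∀ N L : ℕ, L ≤ q →
      |(neighbourCount D q (N + L) : ℝ) - neighbourCount D q N -
        volume.real D * q.totient * (L / q)| ≤ ε * q.totient := by
  filter_upwards [eventually_abs_neighbourCount_sub_le hD (half_pos hε), eventually_gt_atTop 0]
    with q hq hq₀ N L hL
  have hmod : N % q < q := Nat.mod_lt _ hq₀
  have hreduce : (neighbourCount D q (N + L) : ℝ) - neighbourCount D q N =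
      neighbourCount D q (N % q + L) - neighbourCount D q (N % q) := by
    rw [← Nat.div_add_mod' N q, add_assoc, neighbourCount_mul_add, neighbourCount_mul_add,
      Nat.div_add_mod' N q]
    push_cast
    ring
  have hend := hq (N % q + L) (by omega)
  have hstart := hq (N % q) (by omega)
  rw [hreduce]
  calc |(neighbourCount D q (N % q + L) : ℝ) - neighbourCount D q (N % q) -
        volume.real D * q.totient * (L / q)|
      = |(neighbourCount D q (N % q + L) -
          volume.real D * q.totient * ((N % q + L : ℕ) / q)) -
        (neighbourCount D q (N % q) - volume.real D * q.totient * ((N % q : ℕ) / q))| := by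
        push_cast
        congr 1
        ring
    _ ≤ ε / 2 * q.totient + ε / 2 * q.totient := (abs_sub _ _).trans (add_le_add hend hstart)
    _ = ε * q.totient := by ring

end NeighbourCount

section RiemannSum

/-- The sum of `h (m / x) / x` over the integers `0 < m ≤ x`, for a real number `x`. -/
def rightRiemannSum (h : ℝ → ℝ) (x : ℝ) : ℝ := x⁻¹ * ∑ m ∈ Finset.Ioc 0 ⌊x⌋₊, h (m / x)

variable {h : ℝ → ℝ} {x : ℝ}

lemma abs_rightRiemannSum_le {B : ℝ} (hB : ∀ t ∈ Icc (0 : ℝ) 1, |h t| ≤ B) (hx : 0 ≤ x) :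
    |rightRiemannSum h x| ≤ B := by
  have hB₀ : 0 ≤ B := (abs_nonneg _).trans (hB 0 (by simp))
  rcases hx.eq_or_lt with rfl | hx
  · simpa [rightRiemannSum] using hB₀
  rw [rightRiemannSum, abs_mul, abs_of_pos (inv_pos.2 hx), inv_mul_le_iff₀ hx]
  calc |∑ m ∈ Finset.Ioc 0 ⌊x⌋₊, h (m / x)|
      ≤ ∑ m ∈ Finset.Ioc 0 ⌊x⌋₊, |h (m / x)| := Finset.abs_sum_le_sum_abs _ _
    _ ≤ ∑ _m ∈ Finset.Ioc 0 ⌊x⌋₊, B := by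
        refine Finset.sum_le_sum fun m hm => hB _ ⟨by positivity, ?_⟩
        exact (div_le_one hx).2 ((Nat.le_floor_iff hx.le).1 (Finset.mem_Ioc.1 hm).2)
    _ = ⌊x⌋₊ * B := by simp
    _ ≤ x * B := by gcongr; exact Nat.floor_le hx.le

lemma rightRiemannSum_eq_integral (hx : 0 < x) :
    rightRiemannSum h x =
      ∫ t in (0 : ℝ)..1, (Iic (⌊x⌋₊ / x)).indicator (fun t => h (⌈t * x⌉₊ / x)) t := by
  have hpiece : ∀ m : ℕ, EqOn (fun t => h (⌈t * x⌉₊ / x)) (fun _ => h ((m + 1 : ℕ) / x))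
      (uIoc (m / x) ((m + 1 : ℕ) / x)) := fun m t ht => by
    rw [uIoc_of_le (by gcongr; simp), mem_Ioc, div_lt_iff₀ hx, le_div_iff₀ hx] at ht
    have hceil : ⌈t * x⌉₊ = m + 1 := (Nat.ceil_eq_iff m.succ_ne_zero).2 ht
    simp only [hceil]
  have hend : (⌊x⌋₊ : ℝ) / x ∈ Icc (0 : ℝ) 1 :=
    ⟨by positivity, (div_le_one hx).2 (Nat.floor_le hx.le)⟩
  symm
  calc ∫ t in (0 : ℝ)..1, (Iic (⌊x⌋₊ / x)).indicator (fun t => h (⌈t * x⌉₊ / x)) t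
      = ∫ t in ((0 : ℕ) : ℝ) / x..(⌊x⌋₊ : ℝ) / x, h (⌈t * x⌉₊ / x) := by
        rw [Nat.cast_zero, zero_div]
        exact intervalIntegral.integral_indicator hend
    _ = ∑ m ∈ Finset.range ⌊x⌋₊,
          ∫ t in (m : ℝ) / x..((m + 1 : ℕ) : ℝ) / x, h (⌈t * x⌉₊ / x) :=
        (intervalIntegral.sum_integral_adjacent_intervals (a := fun m : ℕ => (m : ℝ) / x)
          fun m _ => (intervalIntegrable_congr (hpiece m)).2 intervalIntegrable_const).symm
    _ = ∑ m ∈ Finset.range ⌊x⌋₊, x⁻¹ * h ((m + 1 : ℕ) / x) := by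
        refine Finset.sum_congr rfl fun m _ => ?_
        rw [intervalIntegral.integral_congr_ae (Eventually.of_forall (hpiece m)),
          intervalIntegral.integral_const, smul_eq_mul]
        push_cast
        ring
    _ = rightRiemannSum h x := by
        rw [rightRiemannSum, Finset.mul_sum, Finset.range_eq_Ico,
          Finset.sum_Ico_add' (fun m : ℕ => x⁻¹ * h (m / x))]
        rfl

lemma tendsto_rightRiemannSum (hh : Continuous h) :
    Tendsto (rightRiemannSum h) atTop (𝓝 (∫ t in (0 : ℝ)..1, h t)) := by
  obtain ⟨B, hB⟩ := (isCompact_Icc (a := (0 : ℝ)) (b := 1)).exists_bound_of_continuousOn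
    hh.continuousOn
  refine Tendsto.congr' (f₁ := fun x : ℝ => ∫ t in (0 : ℝ)..1,
    (Iic (⌊x⌋₊ / x)).indicator (fun t => h (⌈t * x⌉₊ / x)) t) ?_ ?_
  · filter_upwards [eventually_gt_atTop 0] with x hx using (rightRiemannSum_eq_integral hx).symm
  refine intervalIntegral.tendsto_integral_filter_of_dominated_convergence (fun _ => B) ?_ ?_
    intervalIntegrable_const ?_
  · refine Eventually.of_forall fun x => Measurable.aestronglyMeasurable ?_
    exact (hh.measurable.comp (by fun_prop)).indicator measurableSet_Iic
  · filter_upwards [eventually_gt_atTop 0] with x hx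
    refine Eventually.of_forall fun t _ => ?_
    by_cases htx : t ∈ Iic (⌊x⌋₊ / x)
    · rw [indicator_of_mem htx]
      refine hB _ ⟨by positivity, (div_le_one hx).2 (le_trans ?_ (Nat.floor_le hx.le))⟩
      exact_mod_cast Nat.ceil_le.2 ((le_div_iff₀ hx).1 htx)
    · rw [indicator_of_notMem htx, norm_zero]
      exact (norm_nonneg _).trans (hB 0 (by simp))
  · filter_upwards [compl_mem_ae_iff.2 (measure_singleton (1 : ℝ))] with t ht₁ ht
    rw [uIoc_of_le zero_le_one] at ht
    have ht₁ : t < 1 := lt_of_le_of_ne ht.2 ht₁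
    refine ((hh.tendsto t).comp (tendsto_nat_ceil_mul_div_atTop ht.1.le)).congr' ?_
    filter_upwards [tendsto_nat_floor_div_atTop.eventually_const_lt ht₁] with x hx
    exact (indicator_of_mem (s := Iic ((⌊x⌋₊ : ℝ) / x)) hx.le
      fun t => h (⌈t * x⌉₊ / x)).symm

end RiemannSum

section TotientSums

open ArithmeticFunction

lemma totient_eq_sum_moebius {n : ℕ} (hn : 0 < n) :
    (n.totient : ℝ) = ∑ x ∈ n.divisorsAntidiagonal, (moebius x.1 : ℝ) * (x.2 : ℝ) :=
  ((sum_eq_iff_sum_mul_moebius_eq (f := fun n => (n.totient : ℝ)) (g := fun n => (n : ℝ))).1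
    (fun m _ => by exact_mod_cast Nat.sum_totient m) n hn).symm

lemma sum_Ioc_sum_divisorsAntidiagonal {M : Type*} [AddCommMonoid M] (F : ℕ × ℕ → M) (N : ℕ) :
    ∑ n ∈ Finset.Ioc 0 N, ∑ x ∈ n.divisorsAntidiagonal, F x =
      ∑ d ∈ Finset.Ioc 0 N, ∑ m ∈ Finset.Ioc 0 (N / d), F (d, m) := by
  rw [Finset.sum_sigma', Finset.sum_sigma']
  refine Finset.sum_nbij' (fun x => ⟨x.2.1, x.2.2⟩) (fun x => ⟨x.1 * x.2, (x.1, x.2)⟩)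
    ?_ ?_ ?_ ?_ ?_
  · rintro ⟨n, d, m⟩ hx
    simp only [Finset.mem_sigma, Finset.mem_Ioc, Nat.mem_divisorsAntidiagonal] at hx ⊢
    obtain ⟨⟨hn, hnN⟩, rfl, -⟩ := hx
    have hd := Nat.pos_of_mul_pos_right hn
    have hm := Nat.pos_of_mul_pos_left hn
    exact ⟨⟨hd, (Nat.le_mul_of_pos_right d hm).trans hnN⟩, hm,
      (Nat.le_div_iff_mul_le hd).2 (by rwa [mul_comm])⟩
  · rintro ⟨d, m⟩ hx
    simp only [Finset.mem_sigma, Finset.mem_Ioc, Nat.mem_divisorsAntidiagonal] at hx ⊢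
    obtain ⟨⟨hd, -⟩, hm, hmN⟩ := hx
    have hdm : 0 < d * m := Nat.mul_pos hd hm
    exact ⟨⟨hdm, by rw [mul_comm]; exact (Nat.le_div_iff_mul_le hd).1 hmN⟩, trivial, hdm.ne'⟩
  · rintro ⟨n, d, m⟩ hx
    simp only [Finset.mem_sigma, Nat.mem_divisorsAntidiagonal] at hx
    obtain ⟨-, rfl, -⟩ := hx
    rfl
  · exact fun _ _ => rfl
  · exact fun _ _ => rfl

lemma sum_totient_mul_eq (f : ℕ → ℝ) (N : ℕ) :
    ∑ n ∈ Finset.Ioc 0 N, (n.totient : ℝ) * f n =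
      ∑ d ∈ Finset.Ioc 0 N, (moebius d : ℝ) * ∑ m ∈ Finset.Ioc 0 (N / d), m * f (d * m) := by
  simp_rw [Finset.mul_sum]
  rw [← sum_Ioc_sum_divisorsAntidiagonal
    (fun x => (moebius x.1 : ℝ) * ((x.2 : ℝ) * f (x.1 * x.2)))]
  refine Finset.sum_congr rfl fun n hn => ?_
  rw [totient_eq_sum_moebius (Finset.mem_Ioc.1 hn).1, Finset.sum_mul]
  refine Finset.sum_congr rfl fun x hx => ?_
  rw [(Nat.mem_divisorsAntidiagonal.1 hx).1, mul_assoc]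

/-- The constant `∑ μ(d) / d² = 1 / ζ(2)`, the mean value of `φ(n) / n`. -/
def totientConst : ℝ := ∑' d : ℕ, (moebius d : ℝ) / (d : ℝ) ^ 2

lemma totientConst_ne_zero : totientConst ≠ 0 := by
  intro h
  have hζ := LSeries_one_mul_Lseries_moebius (s := 2) (by norm_num)
  have hconst : LSeries (fun n => (moebius n : ℂ)) 2 = (totientConst : ℂ) := by
    rw [totientConst, Complex.ofReal_tsum, LSeries]
    refine tsum_congr fun d => ?_
    rcases eq_or_ne d 0 with rfl | hd
    · simp
    · rw [LSeries.term_of_ne_zero hd]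
      norm_cast
  simp [hconst, h] at hζ

lemma sum_totient_mul_div_sq_eq_tsum (h : ℝ → ℝ) {N : ℕ} (hN : 0 < N) :
    (∑ n ∈ Finset.Ioc 0 N, (n.totient : ℝ) * h (n / N)) / (N : ℝ) ^ 2 =
      ∑' d : ℕ, (moebius d : ℝ) / (d : ℝ) ^ 2 * rightRiemannSum (fun t => t * h t) (N / d) := by
  have hN₀ : (0 : ℝ) < N := by exact_mod_cast hN
  rw [sum_totient_mul_eq (fun n => h (n / N)), tsum_eq_sum (s := Finset.Ioc 0 N), Finset.sum_div]
  · refine Finset.sum_congr rfl fun d hd => ?_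
    have hd₀ : (0 : ℝ) < d := by exact_mod_cast (Finset.mem_Ioc.1 hd).1
    simp only [rightRiemannSum, Nat.floor_div_eq_div, Finset.mul_sum, Finset.sum_div]
    refine Finset.sum_congr rfl fun m _ => ?_
    rw [show ((d * m : ℕ) : ℝ) / N = m / (N / d) by push_cast; field_simp]
    field_simp
  · intro d hd
    rcases Nat.eq_zero_or_pos d with rfl | hd₀
    · simp
    · have hNd : N < d := by simpa [hd₀] using hd
      simp [rightRiemannSum, Nat.floor_div_eq_div, Nat.div_eq_of_lt hNd]

lemma tendsto_sum_totient_mul {h : ℝ → ℝ} (hh : Continuous h) :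
    Tendsto (fun N : ℕ => (∑ n ∈ Finset.Ioc 0 N, (n.totient : ℝ) * h (n / N)) / (N : ℝ) ^ 2)
      atTop (𝓝 (totientConst * ∫ t in (0 : ℝ)..1, t * h t)) := by
  have hth : Continuous fun t => t * h t := by fun_prop
  obtain ⟨B, hB⟩ := (isCompact_Icc (a := (0 : ℝ)) (b := 1)).exists_bound_of_continuousOn
    hth.continuousOn
  rw [totientConst, ← tsum_mul_right]
  refine Tendsto.congr' (f₁ := fun N : ℕ => ∑' d : ℕ,
    (moebius d : ℝ) / (d : ℝ) ^ 2 * rightRiemannSum (fun t => t * h t) (N / d)) ?_ ?_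
  · filter_upwards [eventually_gt_atTop 0] with N hN
      using (sum_totient_mul_div_sq_eq_tsum h hN).symm
  refine tendsto_tsum_of_dominated_convergence (bound := fun d : ℕ => 1 / (d : ℝ) ^ 2 * B)
    ((Real.summable_one_div_nat_pow.2 one_lt_two).mul_right B) (fun d => ?_)
    (Eventually.of_forall fun N d => ?_)
  · rcases Nat.eq_zero_or_pos d with rfl | hd
    · simp
    · refine Tendsto.const_mul _ ((tendsto_rightRiemannSum hth).comp ?_)
      exact tendsto_natCast_atTop_atTop.atTop_div_const (by exact_mod_cast hd)
  · have hμ : ‖(moebius d : ℝ)‖ ≤ 1 := by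
      rw [Real.norm_eq_abs]; exact_mod_cast abs_moebius_le_one (n := d)
    rw [norm_mul, norm_div, norm_pow, Real.norm_natCast]
    gcongr
    exact abs_rightRiemannSum_le hB (by positivity)

lemma tendsto_sum_div_sq_zero {y : ℕ → ℕ → ℝ} {C : ℝ}
    (hbound : ∀ N, ∀ n ∈ Finset.Ioc 0 N, |y N n| ≤ C * n)
    (hsmall : ∀ ε > 0, ∀ᶠ n : ℕ in atTop, ∀ N ≥ n, |y N n| ≤ ε * n) :
    Tendsto (fun N : ℕ => (∑ n ∈ Finset.Ioc 0 N, y N n) / (N : ℝ) ^ 2) atTop (𝓝 0) := by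
  suffices h : (fun N : ℕ => ∑ n ∈ Finset.Ioc 0 N, y N n) =o[atTop] fun N : ℕ => (N : ℝ) ^ 2 from
    h.tendsto_div_nhds_zero
  refine Asymptotics.isLittleO_iff.2 fun ε hε => ?_
  obtain ⟨n₀, hn₀⟩ := eventually_atTop.1 (hsmall (ε / 2) (half_pos hε))
  have hterm : ∀ N, ∀ n ∈ Finset.Ioc 0 N,
      |y N n| ≤ ε / 2 * N + if n < n₀ then |C| * n₀ else 0 := fun N n hn => by
    have hnN : (n : ℝ) ≤ N := by exact_mod_cast (Finset.mem_Ioc.1 hn).2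
    split_ifs with hlt
    · have hle : C * n ≤ |C| * n₀ := by gcongr; exact le_abs_self C
      exact (hbound N n hn).trans (hle.trans (le_add_of_nonneg_left (by positivity)))
    · rw [add_zero]
      exact (hn₀ n (not_lt.1 hlt) N (Finset.mem_Ioc.1 hn).2).trans (by gcongr)
  have hcard : ∀ N, ((Finset.Ioc 0 N).filter (· < n₀)).card ≤ n₀ := fun N => by
    refine (Finset.card_le_card fun n hn => ?_).trans (Finset.card_range n₀).le
    exact Finset.mem_range.2 (Finset.mem_filter.1 hn).2
  have hlarge : ∀ᶠ N : ℕ in atTop, n₀ * (|C| * n₀) ≤ ε / 2 * (N : ℝ) ^ 2 :=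
    (((tendsto_pow_atTop two_ne_zero).comp tendsto_natCast_atTop_atTop).const_mul_atTop
      (half_pos hε)).eventually_ge_atTop _
  filter_upwards [hlarge] with N hN
  rw [Real.norm_eq_abs, norm_pow, Real.norm_natCast]
  calc |∑ n ∈ Finset.Ioc 0 N, y N n|
      ≤ ∑ n ∈ Finset.Ioc 0 N, (ε / 2 * N + if n < n₀ then |C| * n₀ else 0) :=
        (Finset.abs_sum_le_sum_abs _ _).trans (Finset.sum_le_sum (hterm N))
    _ = N * (ε / 2 * N) + ((Finset.Ioc 0 N).filter (· < n₀)).card * (|C| * n₀) := by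
        rw [Finset.sum_add_distrib, ← Finset.sum_filter]
        simp
    _ ≤ N * (ε / 2 * N) + n₀ * (|C| * n₀) := by gcongr; exact hcard N
    _ ≤ ε * (N : ℝ) ^ 2 := by linarith

end TotientSums

section FareyNeighbours

lemma mem_points_iff {Q : ℕ} {r : ℝ} :
    r ∈ points Q ↔ ∃ q ∈ Finset.Ioc 0 Q, ∃ p < q, p.Coprime q ∧ r = (p : ℝ) / q := by
  constructor
  · rintro ⟨⟨hr₀, hr₁⟩, p, q, hpq, hq, hqQ, rfl⟩
    lift q to ℕ using hq.le
    have hq' : (0 : ℝ) < (q : ℤ) := by exact_mod_cast hq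
    have hp : 0 ≤ p := by
      rw [le_div_iff₀ hq', zero_mul] at hr₀
      exact_mod_cast hr₀
    lift p to ℕ using hp
    have hlt : p < q := by
      have := (div_lt_one hq').1 hr₁
      exact_mod_cast this
    exact ⟨q, Finset.mem_Ioc.2 ⟨by exact_mod_cast hq, by exact_mod_cast hqQ⟩, p, hlt,
      by exact_mod_cast hpq, by push_cast; rfl⟩
  · rintro ⟨q, hq, p, hpq, hcop, rfl⟩
    rw [Finset.mem_Ioc] at hq
    have hq' : (0 : ℝ) < q := by exact_mod_cast hq.1
    exact ⟨⟨by positivity, (div_lt_one hq').2 (by exact_mod_cast hpq)⟩, p, q,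
      by exact_mod_cast hcop, by exact_mod_cast hq.1, by exact_mod_cast hq.2, by push_cast; rfl⟩

lemma coprime_of_dvd_mul_add_one {p q n : ℕ} (h : q ∣ p * n + 1) : p.Coprime q :=
  Nat.dvd_one.1 <| (Nat.dvd_add_right (dvd_mul_of_dvd_left (Nat.gcd_dvd_left p q) n)).1
    ((Nat.gcd_dvd_right p q).trans h)

lemma leftNeighbour_eq_div {p q n : ℕ} (hpq : p < q) (h : q ∣ p * n + 1) :
    leftNeighbour q n = (p : ℝ) / q := by
  have hmul : (p : ZMod q) * n = -1 :=
    eq_neg_of_add_eq_zero_left (by exact_mod_cast (ZMod.natCast_eq_zero_iff _ _).2 h)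
  have hinv : (n : ZMod q)⁻¹ = -p :=
    ZMod.inv_eq_of_mul_eq_one _ _ _ (by rw [mul_neg, mul_comm, hmul, neg_neg])
  rw [leftNeighbour, hinv, neg_neg, ZMod.val_cast_of_lt hpq]

lemma exists_leftNeighbour_eq_div {q n : ℕ} (hq : 0 < q) (hn : n.Coprime q) :
    ∃ p < q, q ∣ p * n + 1 ∧ leftNeighbour q n = (p : ℝ) / q := by
  have : NeZero q := ⟨hq.ne'⟩
  refine ⟨(-(n : ZMod q)⁻¹).val, ZMod.val_lt _, ?_, rfl⟩
  rw [← ZMod.natCast_eq_zero_iff]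
  push_cast
  rw [ZMod.natCast_zmod_val, neg_mul, mul_comm, ZMod.coe_mul_inv_eq_one n hn, neg_add_cancel]

/-- The pairs `(q, n)` of denominators of consecutive Farey points of level `Q`. -/
def neighbourPairs (Q : ℕ) : Finset (Σ _ : ℕ, ℕ) :=
  (Finset.Ioc 0 Q).sigma fun q => {n ∈ Finset.Ioc (Q - q) Q | n.Coprime q}

lemma injOn_leftNeighbour (Q : ℕ) :
    InjOn (fun x : Σ _ : ℕ, ℕ => leftNeighbour x.1 x.2) (neighbourPairs Q) := by
  rintro ⟨q, n⟩ hx ⟨q', n'⟩ hx' h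
  simp only [neighbourPairs, Finset.coe_sigma, Set.mem_sigma_iff, Finset.mem_coe, Finset.mem_Ioc,
    Finset.mem_filter] at hx hx'
  obtain ⟨⟨hq, hqQ⟩, ⟨hn, hnQ⟩, hcop⟩ := hx
  obtain ⟨⟨hq', -⟩, ⟨hn', hnQ'⟩, hcop'⟩ := hx'
  obtain ⟨p, -, hp, heq⟩ := exists_leftNeighbour_eq_div hq hcop
  obtain ⟨p', -, hp', heq'⟩ := exists_leftNeighbour_eq_div hq' hcop'
  have hfrac : ((p : ℤ) : ℚ) / (q : ℤ) = ((p' : ℤ) : ℚ) / (q' : ℤ) := by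
    have : (p : ℝ) / q = p' / q' := by rw [← heq, ← heq']; exact h
    rw [← Rat.cast_inj (α := ℝ)]
    push_cast
    exact this
  obtain ⟨hpp, hqq⟩ := Rat.div_int_inj (by exact_mod_cast hq) (by exact_mod_cast hq')
    (coprime_of_dvd_mul_add_one hp) (coprime_of_dvd_mul_add_one hp') hfrac
  obtain rfl : p = p' := by exact_mod_cast hpp
  obtain rfl : q = q' := by exact_mod_cast hqq
  have hdvd : (q : ℤ) ∣ n - n' := by
    refine (Nat.isCoprime_iff_coprime.2 (coprime_of_dvd_mul_add_one hp)).symm.dvd_of_dvd_mul_left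
      ?_
    have := dvd_sub (Int.natCast_dvd_natCast.2 hp) (Int.natCast_dvd_natCast.2 hp')
    push_cast at this
    rwa [add_sub_add_right_eq_sub, ← mul_sub] at this
  have := Int.eq_zero_of_abs_lt_dvd hdvd (by rw [abs_lt]; omega)
  obtain rfl : n = n' := by omega
  rfl

lemma image_leftNeighbour (Q : ℕ) :
    (fun x : Σ _ : ℕ, ℕ => leftNeighbour x.1 x.2) '' neighbourPairs Q = points Q := by
  ext r
  rw [mem_points_iff]
  constructor
  · rintro ⟨⟨q, n⟩, hx, rfl⟩
    rw [Finset.mem_coe, neighbourPairs, Finset.mem_sigma, Finset.mem_filter] at hx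
    obtain ⟨p, hpq, hp, heq⟩ := exists_leftNeighbour_eq_div (Finset.mem_Ioc.1 hx.1).1 hx.2.2
    exact ⟨q, hx.1, p, hpq, coprime_of_dvd_mul_add_one hp, heq⟩
  · rintro ⟨q, hq, p, hpq, hcop, rfl⟩
    have hq' := Finset.mem_Ioc.1 hq
    have hqpos : (0 : ℤ) < q := by exact_mod_cast hq'.1
    obtain ⟨u, v, huv⟩ := Nat.isCoprime_iff_coprime.2 hcop
    -- Reduce the solution `-u` of `p n ≡ -1` modulo `q` into the window `(Q - q, Q]`.
    obtain ⟨hlow, hhigh⟩ := toIocMod_mem_Ioc hqpos ((Q : ℤ) - q) (-u)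
    have hmod := toIocMod_add_toIocDiv_zsmul hqpos ((Q : ℤ) - q) (-u)
    generalize toIocMod hqpos ((Q : ℤ) - q) (-u) = n at hlow hhigh hmod
    generalize toIocDiv hqpos ((Q : ℤ) - q) (-u) = j at hmod
    lift n to ℕ using by omega
    have hdvd : q ∣ p * n + 1 := by
      rw [← Int.natCast_dvd_natCast]
      refine ⟨v - p * j, ?_⟩
      push_cast
      rw [smul_eq_mul] at hmod
      linear_combination p * hmod - huv
    refine ⟨⟨q, n⟩, ?_, leftNeighbour_eq_div hpq hdvd⟩
    rw [Finset.mem_coe, neighbourPairs, Finset.mem_sigma, Finset.mem_filter]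
    exact ⟨hq, Finset.mem_Ioc.2 (by dsimp only; omega),
      coprime_of_dvd_mul_add_one (by rwa [mul_comm])⟩

open Classical in
lemma ncard_pointsIn_and (D : Set UnitAddCircle) (Q : ℕ) (P : ℝ → Prop) :
    {r | r ∈ pointsIn Q D ∧ P r}.ncard = ∑ q ∈ Finset.Ioc 0 Q,
      #{n ∈ Finset.Ioc (Q - q) Q | LeftNeighbourMem D q n ∧ P (leftNeighbour q n)} := by
  set S : Finset (Σ _ : ℕ, ℕ) := (Finset.Ioc 0 Q).sigma fun q =>
    {n ∈ Finset.Ioc (Q - q) Q | LeftNeighbourMem D q n ∧ P (leftNeighbour q n)} with hS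
  have hsub : (S : Set (Σ _ : ℕ, ℕ)) ⊆ neighbourPairs Q := by
    refine Finset.coe_subset.2 (Finset.sigma_mono le_rfl fun q => ?_)
    exact Finset.monotone_filter_right _ fun n _ hn => hn.1.1
  rw [← Finset.card_sigma, ← hS, ← Set.ncard_coe_finset,
    ← ((injOn_leftNeighbour Q).mono hsub).ncard_image]
  congr 1
  ext r
  simp only [pointsIn, ← image_leftNeighbour, mem_image, mem_ofPred_eq]
  constructor
  · rintro ⟨⟨⟨x, hx, rfl⟩, hD⟩, hP⟩
    refine ⟨x, ?_, rfl⟩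
    rw [Finset.mem_coe, neighbourPairs, Finset.mem_sigma, Finset.mem_filter] at hx
    exact Finset.mem_sigma.2 ⟨hx.1, Finset.mem_filter.2 ⟨hx.2.1, ⟨hx.2.2, hD⟩, hP⟩⟩
  · rintro ⟨x, hx, rfl⟩
    have hx' := (Finset.mem_filter.1 (Finset.mem_sigma.1 hx).2).2
    exact ⟨⟨⟨x, hsub hx, rfl⟩, hx'.1.2⟩, hx'.2⟩

end FareyNeighbours

section Gaps

lemma sigma_eq (Q : ℕ) : sigma Q = (Q : ℝ) ^ 2 * (3 / Real.pi ^ 2) := by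
  have hζ : (riemannZeta 2).re = Real.pi ^ 2 / 6 := by
    rw [riemannZeta_two]
    norm_cast
  rw [sigma, hζ]
  field_simp
  ring

lemma sigma_pos {Q : ℕ} (hQ : 0 < Q) : 0 < sigma Q := by
  rw [sigma_eq]
  positivity

/-- The parameter `a` of the explicit formula for the gap distribution at `s`. -/
def gapParam (s : ℝ) : ℝ := (Real.pi ^ 2 / 3 * s)⁻¹

lemma gapParam_pos {s : ℝ} (hs : 0 < s) : 0 < gapParam s := by
  rw [gapParam]
  positivity

lemma inv_sigma_mul (Q : ℕ) (s : ℝ) : (sigma Q)⁻¹ * s = (gapParam s * (Q : ℝ) ^ 2)⁻¹ := by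
  rw [sigma_eq, gapParam, mul_inv, mul_inv, inv_inv, inv_div]
  ring

/-- If `q' > (p' q - p q') n`, then `q' ≥ n + q`: the integer `j = e q' - p' n`, where
`p n + 1 = q e`, satisfies `q' = (p' q - p q') n + q j` and hence is positive. -/
lemma le_mul_of_lt_add {p q n p' q' : ℤ} (hq : 0 < q) (hn : 0 ≤ n) (hdvd : q ∣ p * n + 1)
    (hpos : 0 < p' * q - p * q') (hlt : q' < n + q) : q' ≤ (p' * q - p * q') * n := by
  obtain ⟨e, he⟩ := hdvd
  have hdecomp : q' = (p' * q - p * q') * n + q * (e * q' - p' * n) := by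
    linear_combination q' * he
  by_contra! hgt
  have hj : 0 < e * q' - p' * n := pos_of_mul_pos_right (by linarith) hq.le
  have hqj : q ≤ q * (e * q' - p' * n) := le_mul_of_one_le_right hq.le hj
  have hkn : n ≤ (p' * q - p * q') * n := le_mul_of_one_le_left hn hpos
  linarith

variable {Q q n p : ℕ}

lemma one_le_mul_of_add_mem_points (hq : 0 < q) (hn : Q - q < n) (hdvd : q ∣ p * n + 1) {δ : ℝ}
    (hδ : 0 < δ) {m : ℤ} (hmem : (p : ℝ) / q + δ + m ∈ points Q) : 1 ≤ q * n * δ := by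
  obtain ⟨-, p', q', -, hq', hq'Q, heq⟩ := hmem
  have hq₀ : (0 : ℝ) < q := by exact_mod_cast hq
  have hq'₀ : (0 : ℝ) < q' := by exact_mod_cast hq'
  have hdet : (((p' - m * q') * q - p * q' : ℤ) : ℝ) = q * q' * δ := by
    field_simp at heq
    push_cast
    linarith
  have hpos : 0 < (p' - m * q') * q - p * q' := by
    have : (0 : ℝ) < ((p' - m * q') * q - p * q' : ℤ) := by rw [hdet]; positivity
    exact_mod_cast this
  have hle := le_mul_of_lt_add (by exact_mod_cast hq) n.cast_nonneg (by exact_mod_cast hdvd) hpos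
    (by omega)
  have hleR : (q' : ℝ) ≤ q * q' * δ * n := by
    rw [← hdet]
    exact_mod_cast hle
  exact le_of_mul_le_mul_left (by linarith) hq'₀

lemma fract_add_one_div_mem_points (hq : 0 < q) (hn : n ∈ Finset.Ioc (Q - q) Q)
    (hdvd : q ∣ p * n + 1) : Int.fract ((p : ℝ) / q + 1 / (q * n)) ∈ points Q := by
  rw [Finset.mem_Ioc] at hn
  have hn₀ : 0 < n := by omega
  obtain ⟨e, he⟩ := hdvd
  have heq : (p : ℝ) / q + 1 / (q * n) = e / n := by
    have : (p : ℝ) * n + 1 = q * e := by exact_mod_cast he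
    field_simp
    linarith
  refine ⟨⟨Int.fract_nonneg _, Int.fract_lt_one _⟩, e - n * ⌊(e : ℝ) / n⌋, n, ?_,
    by exact_mod_cast hn₀, by exact_mod_cast hn.2, ?_⟩
  · have heZ : (p : ℤ) * n + 1 = q * e := by exact_mod_cast he
    rw [← Int.isCoprime_iff_gcd_eq_one]
    exact ⟨q, q * ⌊(e : ℝ) / n⌋ - p, by linear_combination -heZ⟩
  · rw [heq, Int.fract]
    push_cast
    field_simp

lemma near_eq_empty_iff (hq : q ∈ Finset.Ioc 0 Q) (hn : n ∈ Finset.Ioc (Q - q) Q)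
    (hdvd : q ∣ p * n + 1) (s : ℝ) :
    near Q (Ioc 0 s) ((p : ℝ) / q) = ∅ ↔ (q : ℝ) * n * ((sigma Q)⁻¹ * s) < 1 := by
  rw [Finset.mem_Ioc] at hq
  have hn' := Finset.mem_Ioc.1 hn
  have hσ : 0 < sigma Q := sigma_pos (by omega)
  have hq₀ : (0 : ℝ) < q := by exact_mod_cast hq.1
  have hn₀ : (0 : ℝ) < n := by exact_mod_cast Nat.zero_lt_of_lt hn'.1
  rw [← not_nonempty_iff_eq_empty, ← not_le, not_iff_not]
  constructor
  · rintro ⟨x, ⟨t, ht, m, rfl⟩, hx⟩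
    calc 1 ≤ q * n * ((sigma Q)⁻¹ * t) :=
          one_le_mul_of_add_mem_points hq.1 hn'.1 hdvd (mul_pos (inv_pos.2 hσ) ht.1) hx
      _ ≤ q * n * ((sigma Q)⁻¹ * s) := by gcongr; exact ht.2
  · intro hle
    refine ⟨_, ⟨sigma Q / (q * n), ⟨by positivity, ?_⟩, -⌊(p : ℝ) / q + 1 / (q * n)⌋, ?_⟩,
      fract_add_one_div_mem_points hq.1 hn hdvd⟩
    · rw [div_le_iff₀ (by positivity)]
      rw [inv_mul_eq_div, mul_div_assoc', one_le_div hσ] at hle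
      linarith
    · rw [Int.fract, Int.cast_neg, ← sub_eq_add_neg]
      congr 2
      field_simp

lemma near_leftNeighbour_eq_empty_iff (hq : q ∈ Finset.Ioc 0 Q) (hn : n ∈ Finset.Ioc (Q - q) Q)
    (hcop : n.Coprime q) {s : ℝ} (hs : 0 < s) :
    near Q (Ioc 0 s) (leftNeighbour q n) = ∅ ↔ n < ⌈gapParam s * (Q : ℝ) ^ 2 / q⌉₊ := by
  have hq' := Finset.mem_Ioc.1 hq
  have hq₀ : (0 : ℝ) < q := by exact_mod_cast hq'.1
  have hQ₀ : (0 : ℝ) < Q := by exact_mod_cast hq'.1.trans_le hq'.2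
  have ha := gapParam_pos hs
  obtain ⟨p, -, hdvd, heq⟩ := exists_leftNeighbour_eq_div hq'.1 hcop
  rw [heq, near_eq_empty_iff hq hn hdvd s, inv_sigma_mul, ← div_eq_mul_inv,
    div_lt_one (by positivity), Nat.lt_ceil, lt_div_iff₀ hq₀, mul_comm (n : ℝ)]

end Gaps

section GapLimit

lemma neighbourCount_add_le (D : Set UnitAddCircle) (q N L : ℕ) :
    neighbourCount D q (N + L) ≤ neighbourCount D q N + L := by
  classical
  rw [neighbourCount, Nat.count_add]
  exact Nat.add_le_add_left (Nat.count_le _) _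

open Classical in
lemma card_filter_Ico_leftNeighbourMem (D : Set UnitAddCircle) (q N L : ℕ) :
    (#{n ∈ Finset.Ico N (N + L) | LeftNeighbourMem D q n} : ℝ) =
      neighbourCount D q (N + L) - neighbourCount D q N := by
  simp only [neighbourCount, Nat.count_eq_card_filter_range, Finset.natCast_card_filter]
  exact Finset.sum_Ico_eq_sub _ (Nat.le_add_right N L)

variable {D : Set UnitAddCircle}

lemma abs_neighbourCount_add_sub_le {q L : ℕ} (N : ℕ) (hL : L ≤ q) :
    |(neighbourCount D q (N + L) : ℝ) - neighbourCount D q N -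
      volume.real D * q.totient * (L / q)| ≤ q := by
  have hLq : (L : ℝ) ≤ q := by exact_mod_cast hL
  have hcount : (neighbourCount D q (N + L) : ℝ) ≤ neighbourCount D q N + L := by
    exact_mod_cast neighbourCount_add_le D q N L
  have hmono : (neighbourCount D q N : ℝ) ≤ neighbourCount D q (N + L) := by
    exact_mod_cast neighbourCount_mono (Nat.le_add_right N L)
  refine abs_sub_le_of_nonneg_of_le (by linarith) (by linarith) (by positivity) ?_
  calc volume.real D * q.totient * (L / q) ≤ 1 * q * 1 := by
        gcongr
        exacts [measureReal_le_one, Nat.totient_le q, div_le_one_of_le₀ hLq q.cast_nonneg]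
    _ = q := by ring

lemma tendsto_sum_neighbourCount_sub (hD : volume (frontier D) = 0) {h : ℝ → ℝ}
    (hh : Continuous h) {L : ℕ → ℕ → ℕ} (N : ℕ → ℕ → ℕ) (hL : ∀ Q, ∀ q ∈ Finset.Ioc 0 Q, L Q q ≤ q)
    (hLh : ∀ Q, ∀ q ∈ Finset.Ioc 0 Q, |(L Q q : ℝ) / q - h (q / Q)| ≤ 1 / q) :
    Tendsto (fun Q : ℕ => (∑ q ∈ Finset.Ioc 0 Q,
      ((neighbourCount D q (N Q q + L Q q) : ℝ) - neighbourCount D q (N Q q))) / (Q : ℝ) ^ 2)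
      atTop (𝓝 (volume.real D * (totientConst * ∫ t in (0 : ℝ)..1, t * h t))) := by
  set x : ℕ → ℕ → ℝ := fun Q q =>
    neighbourCount D q (N Q q + L Q q) - neighbourCount D q (N Q q)
  have hφ : ∀ q : ℕ, (q.totient : ℝ) ≤ q := fun q => by exact_mod_cast Nat.totient_le q
  have hsplit : ∀ Q, ∀ q ∈ Finset.Ioc 0 Q, |x Q q - volume.real D * (q.totient * h (q / Q))| ≤
      |x Q q - volume.real D * q.totient * (L Q q / q)| + 1 := fun Q q hq => by
    have hq₀ : (0 : ℝ) < q := by exact_mod_cast (Finset.mem_Ioc.1 hq).1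
    refine (abs_sub_le _ (volume.real D * q.totient * (L Q q / q)) _).trans (by
      gcongr
      rw [← mul_assoc, ← mul_sub, abs_mul, abs_of_nonneg (by positivity)]
      calc volume.real D * q.totient * |(L Q q : ℝ) / q - h (q / Q)| ≤ 1 * q * (1 / q) := by
            gcongr
            exacts [measureReal_le_one, Nat.totient_le q, hLh Q q hq]
        _ = 1 := by field_simp)
  have herror : Tendsto (fun Q : ℕ => (∑ q ∈ Finset.Ioc 0 Q,
      (x Q q - volume.real D * (q.totient * h (q / Q)))) / (Q : ℝ) ^ 2) atTop (𝓝 0) := by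
    refine tendsto_sum_div_sq_zero (C := 2) (fun Q q hq => ?_) fun ε hε => ?_
    · have hq₁ : (1 : ℝ) ≤ q := by exact_mod_cast (Finset.mem_Ioc.1 hq).1
      linarith [hsplit Q q hq, abs_neighbourCount_add_sub_le (D := D) (N Q q) (hL Q q hq)]
    · filter_upwards [eventually_abs_neighbourCount_add_sub_le hD (half_pos hε),
        (tendsto_natCast_atTop_atTop.const_mul_atTop (half_pos hε)).eventually_ge_atTop 1,
        eventually_gt_atTop 0] with q hq hq₁ hq₀ Q hQ
      have hmem : q ∈ Finset.Ioc 0 Q := Finset.mem_Ioc.2 ⟨hq₀, hQ⟩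
      calc |x Q q - volume.real D * (q.totient * h (q / Q))|
          ≤ ε / 2 * q.totient + 1 := (hsplit Q q hmem).trans (by gcongr; exact hq _ _ (hL Q q hmem))
        _ ≤ ε * q := by nlinarith [hφ q]
  refine ((herror.add ((tendsto_sum_totient_mul hh).const_mul (volume.real D))).congr
    fun Q => ?_).trans_eq (by rw [zero_add])
  rw [Finset.sum_sub_distrib, ← Finset.mul_sum]
  ring

/-- The proportion of the interval `(1 - t, 1]` on which `t y < a`. -/
def gapProfile (a t : ℝ) : ℝ := max 0 (min 1 (a / t ^ 2 - 1 / t + 1))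

lemma gapProfile_of_le {a t : ℝ} (ht : t ≤ a) : gapProfile a t = 1 := by
  have hle : 1 ≤ a / t ^ 2 - 1 / t + 1 := by
    rcases eq_or_ne t 0 with rfl | ht₀
    · simp
    · have heq : a / t ^ 2 - 1 / t = (a - t) / t ^ 2 := by field_simp
      have hnonneg : 0 ≤ (a - t) / t ^ 2 := div_nonneg (sub_nonneg.2 ht) (sq_nonneg t)
      linarith
  rw [gapProfile, min_eq_left hle, max_eq_right zero_le_one]

lemma continuous_gapProfile {a : ℝ} (ha : 0 < a) : Continuous (gapProfile a) := by
  rw [continuous_iff_continuousAt]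
  intro t
  rcases eq_or_ne t 0 with rfl | ht
  · refine (continuousAt_const (y := (1 : ℝ))).congr ?_
    filter_upwards [Iio_mem_nhds ha] with t ht using (gapProfile_of_le (le_of_lt ht)).symm
  · unfold gapProfile
    fun_prop (disch := positivity)

/-- The limiting gap distribution as a function of the parameter `a = gapParam s`. -/
def gapIntegral (a : ℝ) : ℝ := ∫ t in (0 : ℝ)..1, 2 * t * gapProfile a t

/-- The number of `n ∈ (Q - q, Q]` with `n < ⌈a Q² / q⌉`, that is, with `q n < a Q²`. -/
def windowLength (a : ℝ) (Q q : ℕ) : ℕ := min (Q + 1) ⌈a * (Q : ℝ) ^ 2 / q⌉₊ - (Q + 1 - q)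

lemma windowLength_le {a : ℝ} {Q q : ℕ} (hq : q ≤ Q) : windowLength a Q q ≤ q := by
  rw [windowLength]
  omega

lemma abs_windowLength_div_sub_gapProfile_le {a : ℝ} (ha : 0 ≤ a) {Q q : ℕ}
    (hq : q ∈ Finset.Ioc 0 Q) : |(windowLength a Q q : ℝ) / q - gapProfile a (q / Q)| ≤ 1 / q := by
  rw [Finset.mem_Ioc] at hq
  have hq₀ : (0 : ℝ) < q := by exact_mod_cast hq.1
  have hQ₀ : (0 : ℝ) < Q := by exact_mod_cast hq.1.trans_le hq.2
  set y : ℝ := a * (Q : ℝ) ^ 2 / q with hy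
  have hceil_le : (⌈y⌉₊ : ℝ) < y + 1 := Nat.ceil_lt_add_one (by positivity)
  have hle_ceil : y ≤ ⌈y⌉₊ := Nat.le_ceil y
  have hlength : (windowLength a Q q : ℝ) = max 0 (min (q : ℝ) (⌈y⌉₊ - Q - 1 + q)) := by
    have : (windowLength a Q q : ℤ) = max 0 (min (q : ℤ) ((⌈y⌉₊ : ℕ) - Q - 1 + q : ℤ)) := by
      rw [windowLength, ← hy]
      generalize ⌈y⌉₊ = c
      omega
    exact_mod_cast congrArg (Int.cast : ℤ → ℝ) this
  have hprofile : gapProfile a (q / Q) = max 0 (min (q : ℝ) (y - Q + q)) / q := by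
    have : a / ((q : ℝ) / Q) ^ 2 - 1 / ((q : ℝ) / Q) + 1 = (y - Q + q) / q := by
      rw [hy]
      field_simp
    rw [gapProfile, this, ← max_div_div_right hq₀.le, ← min_div_div_right hq₀.le, zero_div,
      div_self hq₀.ne']
  rw [hlength, hprofile, ← sub_div, abs_div, abs_of_pos hq₀]
  gcongr
  refine (abs_max_sub_max_le_max _ _ _ _).trans (max_le (by simp) ?_)
  refine (abs_min_sub_min_le_max _ _ _ _).trans (max_le (by simp) ?_)
  rw [abs_le]
  constructor <;> linarith

lemma ncard_pointsIn (D : Set UnitAddCircle) (Q : ℕ) :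
    ((pointsIn Q D).ncard : ℝ) = ∑ q ∈ Finset.Ioc 0 Q,
      ((neighbourCount D q (Q + 1 - q + q) : ℝ) - neighbourCount D q (Q + 1 - q)) := by
  classical
  have hcount := ncard_pointsIn_and D Q fun _ => True
  simp only [and_true] at hcount
  rw [show pointsIn Q D = {r | r ∈ pointsIn Q D} from rfl, hcount, Nat.cast_sum]
  refine Finset.sum_congr rfl fun q hq => ?_
  rw [← card_filter_Ico_leftNeighbourMem]
  congr 3
  ext n
  simp only [Finset.mem_Ioc, Finset.mem_Ico] at hq ⊢
  omega

lemma ncard_near_eq_empty (D : Set UnitAddCircle) (Q : ℕ) {s : ℝ} (hs : 0 < s) :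
    ({r | r ∈ pointsIn Q D ∧ near Q (Ioc 0 s) r = ∅}.ncard : ℝ) = ∑ q ∈ Finset.Ioc 0 Q,
      ((neighbourCount D q (Q + 1 - q + windowLength (gapParam s) Q q) : ℝ) -
        neighbourCount D q (Q + 1 - q)) := by
  classical
  rw [ncard_pointsIn_and, Nat.cast_sum]
  refine Finset.sum_congr rfl fun q hq => ?_
  rw [← card_filter_Ico_leftNeighbourMem]
  congr 2
  have hwindow : ∀ n, n ∈ Finset.Ico (Q + 1 - q) (Q + 1 - q + windowLength (gapParam s) Q q) ↔
      n ∈ Finset.Ioc (Q - q) Q ∧ n < ⌈gapParam s * (Q : ℝ) ^ 2 / q⌉₊ := fun n => by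
    simp only [windowLength, Finset.mem_Ioc, Finset.mem_Ico] at hq ⊢
    omega
  ext n
  simp only [Finset.mem_filter, hwindow]
  constructor
  · rintro ⟨hn, hmem, hempty⟩
    exact ⟨⟨hn, (near_leftNeighbour_eq_empty_iff hq hn hmem.1 hs).1 hempty⟩, hmem⟩
  · rintro ⟨⟨hn, hlt⟩, hmem⟩
    exact ⟨hn, hmem, (near_leftNeighbour_eq_empty_iff hq hn hmem.1 hs).2 hlt⟩

lemma tendsto_P0Q {s : ℝ} (hs : 0 < s) (hD : volume (frontier D) = 0)
    (hDi : (interior D).Nonempty) :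
    Tendsto (fun Q : ℕ => P0Q Q 0 D (Ioc 0 s)) atTop
      (𝓝 (gapIntegral (gapParam s))) := by
  have ha := gapParam_pos hs
  have hnum := tendsto_sum_neighbourCount_sub hD (continuous_gapProfile ha)
    (fun Q q => Q + 1 - q) (fun Q q hq => windowLength_le (Finset.mem_Ioc.1 hq).2)
    (fun Q q hq => abs_windowLength_div_sub_gapProfile_le ha.le hq)
  have hden := tendsto_sum_neighbourCount_sub hD (h := fun _ => 1) continuous_const
    (fun Q q => Q + 1 - q) (L := fun _ q => q) (fun _ _ _ => le_rfl) (fun Q q hq => by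
      have hq₀ : (q : ℝ) ≠ 0 := by exact_mod_cast (Finset.mem_Ioc.1 hq).1.ne'
      simp [div_self hq₀])
  simp only [← ncard_near_eq_empty D _ hs] at hnum
  simp only [← ncard_pointsIn] at hden
  have hρ : volume.real D ≠ 0 := by
    rw [measureReal_ne_zero_iff]
    exact ((isOpen_interior.measure_pos volume hDi).trans_le (measure_mono interior_subset)).ne'
  have hmass : ∫ t in (0 : ℝ)..1, t * (1 : ℝ) = 1 / 2 := by simp [integral_id]
  have hratio : volume.real D * (totientConst * ∫ t in (0 : ℝ)..1, t * gapProfile (gapParam s) t) /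
      (volume.real D * (totientConst * ∫ t in (0 : ℝ)..1, t * (1 : ℝ))) =
        gapIntegral (gapParam s) := by
    have hC := totientConst_ne_zero
    simp_rw [gapIntegral, mul_assoc (2 : ℝ)]
    rw [hmass, intervalIntegral.integral_const_mul]
    field_simp
  rw [← hratio]
  refine (hnum.div hden ?_).congr' ?_
  · rw [hmass]
    exact mul_ne_zero hρ (mul_ne_zero totientConst_ne_zero (by norm_num))
  · filter_upwards [eventually_gt_atTop 0] with Q hQ
    have hQ₀ : (Q : ℝ) ^ 2 ≠ 0 := by positivity
    simp only [Pi.div_apply, P0Q, Nat.cast_zero, Set.encard_eq_zero]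
    exact div_div_div_cancel_right₀ hQ₀ _ _

end GapLimit

section Horocycle

lemma vecMul_hMat (p q b : ℝ) : ![p, q] ᵥ* hMat b = ![p, p * b + q] := by
  ext i
  fin_cases i <;> simp [hMat, Matrix.vecMul, dotProduct]

lemma vecMul_aMat (v : Fin 2 → ℝ) (y : ℝ) : v ᵥ* aMat y = ![v 0 * y, v 1 * y⁻¹] := by
  ext i
  fin_cases i <;> simp [aMat, Matrix.vecMul, dotProduct]

lemma mem_coneScaled_iff {l : ℝ} (hl : 0 < l) (A : Set ℝ) (u v : ℝ) :
    ![u, v] ∈ coneScaled l A ↔ ![u / √l, √l * v] ∈ cone A := by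
  have hx : √l ≠ 0 := (Real.sqrt_pos.2 hl).ne'
  constructor
  · rintro ⟨w, hw, hwv⟩
    simp only [vecMul_aMat] at hwv
    obtain rfl : w 0 * √l = u := congrFun hwv 0
    obtain rfl : w 1 * (√l)⁻¹ = v := congrFun hwv 1
    convert hw using 1
    ext i
    fin_cases i <;> simp [hx, mul_left_comm]
  · intro h
    refine ⟨_, h, ?_⟩
    simp [vecMul_aMat, hx, mul_comm √l v]

lemma mem_cone_Ioc_iff {s : ℝ} (hs : 0 < s) (u y : ℝ) :
    ![u, y] ∈ cone (Ioc 0 s) ↔ 0 < y ∧ y ≤ 1 ∧ 0 < u ∧ gapParam s * u ≤ y := by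
  have ha := gapParam_pos hs
  have hσ : (sigma 1)⁻¹ * s = (gapParam s)⁻¹ := by simp [inv_sigma_mul]
  have hσ₀ : 0 < sigma 1 := sigma_pos one_pos
  simp only [cone, mem_ofPred_eq, Matrix.cons_val_zero, Matrix.cons_val_one]
  refine and_congr_right fun hy => and_congr_right fun _ => ?_
  rw [LinearOrderedField.smul_Ioc (by positivity), mem_Ioc, mul_zero, mul_right_comm, hσ,
    le_inv_mul_iff₀ ha]

/-- `m = ⌊1 / x - b⌋` works: otherwise `x (b + m) > 1 - x` would force `q ≤ p m`, and hence
`x (x (p b + q)) ≤ p x (x (b + m)) < p a`. -/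
lemma exists_int_add_mem_Icc {x a b : ℝ} (hx : 0 < x) (hx₁ : x ≤ 1) {p q : ℤ} (hp : 0 < p)
    (hle : x * (p * b + q) ≤ 1) (ha : a * (p / x) ≤ x * (p * b + q)) :
    ∃ m : ℤ, b + m ∈ Icc (a / x ^ 2) (1 / x) := by
  have hp₁ : (1 : ℝ) ≤ p := by exact_mod_cast hp
  set m : ℤ := ⌊1 / x - b⌋
  have hm : (m : ℝ) ≤ 1 / x - b := Int.floor_le _
  have hlow : 1 - x < x * (b + m) := by
    have : x * (1 / x - b) < x * (m + 1) := by
      gcongr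
      exact Int.lt_floor_add_one _
    rw [mul_sub, mul_one_div_cancel hx.ne'] at this
    linarith
  have hqm : q ≤ p * m := by
    by_contra! hlt
    have hlt' : p * (m : ℝ) + 1 ≤ q := by exact_mod_cast hlt
    have hmul : x * (b + m) ≤ p * (x * (b + m)) := le_mul_of_one_le_left (by linarith) hp₁
    have : x * (p * (m : ℝ) + 1) ≤ x * q := by gcongr
    linarith
  have hqm' : (q : ℝ) ≤ p * m := by exact_mod_cast hqm
  refine ⟨m, ?_, by linarith⟩
  rw [div_le_iff₀ (by positivity)]
  refine le_of_mul_le_mul_left ?_ (zero_lt_one.trans_le hp₁)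
  calc p * a = x * (a * (p / x)) := by field_simp
    _ ≤ x * (x * (p * b + q)) := by gcongr
    _ ≤ x * (x * (p * b + p * m)) := by gcongr
    _ = p * ((b + m) * x ^ 2) := by ring

lemma image_primitive_inter_coneScaled_nonempty_iff {l s : ℝ} (hl : 0 < l) (hl₁ : l ≤ 1)
    (hs : 0 < s) (b : ℝ) :
    (((fun v => v ᵥ* hMat b) '' primitive) ∩ coneScaled l (Ioc 0 s)).Nonempty ↔
      ∃ m : ℤ, b + m ∈ Icc (gapParam s / √l ^ 2) (1 / √l) := by
  have hx : 0 < √l := Real.sqrt_pos.2 hl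
  have ha := gapParam_pos hs
  constructor
  · rintro ⟨-, ⟨-, ⟨p, q, -, rfl⟩, rfl⟩, hmem⟩
    simp only [vecMul_hMat] at hmem
    rw [mem_coneScaled_iff hl, mem_cone_Ioc_iff hs] at hmem
    obtain ⟨-, hle, hp, hslope⟩ := hmem
    have hp' : (0 : ℝ) < p := (div_pos_iff_of_pos_right hx).1 hp
    exact exists_int_add_mem_Icc hx (Real.sqrt_le_one.2 hl₁) (by exact_mod_cast hp') hle hslope
  · rintro ⟨m, hlow, hhigh⟩
    refine ⟨![1, b + m], ⟨![((1 : ℤ) : ℝ), (m : ℝ)], ⟨1, m, by simp, rfl⟩, ?_⟩, ?_⟩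
    · simp only [vecMul_hMat]
      simp
    · have hpos : 0 < b + m := lt_of_lt_of_le (by positivity) hlow
      rw [mem_coneScaled_iff hl, mem_cone_Ioc_iff hs]
      refine ⟨by positivity, by rwa [← le_div_iff₀' hx], by positivity, ?_⟩
      calc gapParam s * (1 / √l) = √l * (gapParam s / √l ^ 2) := by field_simp
        _ ≤ √l * (b + m) := by gcongr

lemma coe_mem_closedBall_iff_exists_add_mem_Icc (α β b : ℝ) :
    (b : UnitAddCircle) ∈
        Metric.closedBall (((α + β) / 2 : ℝ) : UnitAddCircle) ((β - α) / 2) ↔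
      ∃ m : ℤ, b + m ∈ Icc α β := by
  have hpre :=
    AddCircle.coe_real_preimage_closedBall_eq_iUnion (1 : ℝ) ((α + β) / 2) ((β - α) / 2)
  rw [← mem_preimage (f := ((↑) : ℝ → UnitAddCircle)), hpre, mem_iUnion]
  refine (Equiv.neg ℤ).exists_congr fun m => ?_
  simp only [Real.closedBall_eq_Icc, mem_Icc, zsmul_eq_mul, mul_one, Equiv.neg_apply, Int.cast_neg]
  constructor <;> rintro ⟨h₁, h₂⟩ <;> constructor <;> linarith

lemma volume_real_forall_add_notMem_Icc (α β : ℝ) :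
    (volume : Measure ℝ).real {b | b ∈ Ico (0 : ℝ) 1 ∧ ¬ ∃ m : ℤ, b + m ∈ Icc α β} =
      max 0 (min 1 (α - β + 1)) := by
  set B : Set UnitAddCircle := Metric.closedBall (((α + β) / 2 : ℝ) : UnitAddCircle) ((β - α) / 2)
  have hvolB : volume.real B = max 0 (min 1 (β - α)) := by
    rw [measureReal_def, AddCircle.volume_closedBall, mul_div_cancel₀ _ two_ne_zero,
      ENNReal.toReal_ofReal', max_comm]
  have hpre : {b | b ∈ Ico (0 : ℝ) 1 ∧ ¬ ∃ m : ℤ, b + m ∈ Icc α β} =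
      ((↑) : ℝ → UnitAddCircle) ⁻¹' Bᶜ ∩ Ico 0 1 := by
    ext b
    rw [mem_ofPred_eq, ← coe_mem_closedBall_iff_exists_add_mem_Icc, and_comm]
    rfl
  have hBm : MeasurableSet B := Metric.isClosed_closedBall.measurableSet
  have hvol : volume (((↑) : ℝ → UnitAddCircle) ⁻¹' Bᶜ ∩ Ico 0 1) = volume Bᶜ := by
    rw [← (UnitAddCircle.measurePreserving_mk 0).measure_preimage hBm.compl.nullMeasurableSet,
      Measure.restrict_apply' measurableSet_Ioc, zero_add]
    exact measure_congr ((ae_eq_refl _).inter Ico_ae_eq_Ioc)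
  rw [hpre, measureReal_def, hvol, ← measureReal_def, probReal_compl_eq_one_sub hBm, hvolB]
  grind

lemma p0_eq_gapProfile {l s : ℝ} (hl : 0 < l) (hl₁ : l ≤ 1) (hs : 0 < s) :
    p0 0 (coneScaled l (Ioc 0 s)) = gapProfile (gapParam s) √l := by
  rw [p0, gapProfile, ← volume_real_forall_add_notMem_Icc]
  congr 1
  ext b
  rw [mem_ofPred_eq, mem_ofPred_eq, ← image_primitive_inter_coneScaled_nonempty_iff hl hl₁ hs,
    Set.not_nonempty_iff_eq_empty, Nat.cast_zero, Set.encard_eq_zero]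

lemma P0_eq_gapIntegral {s : ℝ} (hs : 0 < s) : P0 0 (Ioc 0 s) = gapIntegral (gapParam s) := by
  have hprofile : P0 0 (Ioc 0 s) = ∫ l in (0 : ℝ)..1, gapProfile (gapParam s) √l := by
    refine intervalIntegral.integral_congr_ae (ae_of_all _ fun l hl => ?_)
    rw [uIoc_of_le zero_le_one] at hl
    exact p0_eq_gapProfile hl.1 hl.2 hs
  have hsubst := intervalIntegral.integral_comp_mul_deriv (a := 0) (b := 1)
    (f := fun t : ℝ => t ^ 2) (f' := fun t => 2 * t) (g := fun l => gapProfile (gapParam s) √l)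
    (fun t _ => by simpa using hasDerivAt_pow 2 t) (by fun_prop)
    ((continuous_gapProfile (gapParam_pos hs)).comp Real.continuous_sqrt)
  rw [one_pow, zero_pow two_ne_zero] at hsubst
  rw [hprofile, ← hsubst]
  refine intervalIntegral.integral_congr fun t ht => ?_
  rw [uIcc_of_le zero_le_one] at ht
  simp only [Function.comp_apply, Real.sqrt_sq ht.1, mul_comm]

end Horocycle

section ExplicitFormula

variable {a : ℝ}

lemma gapProfile_eq_max_min_div {t : ℝ} (ht : t ≠ 0) :
    gapProfile a t = max 0 (min 1 ((t ^ 2 - t + a) / t ^ 2)) := by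
  rw [gapProfile]
  congr 2
  field_simp
  ring

lemma gapProfile_of_nonneg {t : ℝ} (ht : 0 < t) (hat : a ≤ t) (hnonneg : 0 ≤ t ^ 2 - t + a) :
    gapProfile a t = (t ^ 2 - t + a) / t ^ 2 := by
  have hle : (t ^ 2 - t + a) / t ^ 2 ≤ 1 := (div_le_one (by positivity)).2 (by linarith)
  rw [gapProfile_eq_max_min_div ht.ne', min_eq_right hle, max_eq_right (by positivity)]

lemma gapProfile_of_nonpos {t : ℝ} (ht : t ≠ 0) (hnonpos : t ^ 2 - t + a ≤ 0) :
    gapProfile a t = 0 := by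
  rw [gapProfile_eq_max_min_div ht, max_eq_left]
  exact min_le_of_right_le (div_nonpos_of_nonpos_of_nonneg hnonpos (by positivity))

lemma intervalIntegrable_mul_gapProfile (ha : 0 < a) (u v : ℝ) :
    IntervalIntegrable (fun t => 2 * t * gapProfile a t) volume u v :=
  ((continuous_const.mul continuous_id).mul (continuous_gapProfile ha)).intervalIntegrable u v

lemma integral_mul_gapProfile_of_le {v : ℝ} (hv : 0 ≤ v) (hva : v ≤ a) :
    ∫ t in (0 : ℝ)..v, 2 * t * gapProfile a t = v ^ 2 := by
  have hcongr : ∫ t in (0 : ℝ)..v, 2 * t * gapProfile a t = ∫ t in (0 : ℝ)..v, 2 * t := by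
    refine intervalIntegral.integral_congr fun t ht => ?_
    rw [uIcc_of_le hv] at ht
    simp only [gapProfile_of_le (ht.2.trans hva), mul_one]
  rw [hcongr, intervalIntegral.integral_const_mul, integral_id]
  ring

lemma integral_mul_gapProfile_of_nonneg {u v : ℝ} (ha : 0 < a) (hau : a ≤ u)
    (huv : u ≤ v)
    (hnonneg : ∀ t ∈ Icc u v, 0 ≤ t ^ 2 - t + a) :
    ∫ t in u..v, 2 * t * gapProfile a t =
      (2 * a * Real.log v - 2 * v + v ^ 2) - (2 * a * Real.log u - 2 * u + u ^ 2) := by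
  have hderiv : ∀ t ∈ uIcc u v, HasDerivAt (fun t => 2 * a * Real.log t - 2 * t + t ^ 2)
      (2 * t * gapProfile a t) t := fun t ht => by
    rw [uIcc_of_le huv] at ht
    have hat : a ≤ t := hau.trans ht.1
    have ht₀ : 0 < t := ha.trans_le hat
    refine ((((Real.hasDerivAt_log ht₀.ne').const_mul (2 * a)).sub
      ((hasDerivAt_id' t).const_mul 2)).add (hasDerivAt_pow 2 t)).congr_deriv ?_
    rw [gapProfile_of_nonneg ht₀ hat (hnonneg t ht)]
    field_simp
    ring
  exact intervalIntegral.integral_eq_sub_of_hasDerivAt hderiv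
    (intervalIntegrable_mul_gapProfile ha u v)

lemma integral_mul_gapProfile_of_nonpos {u v : ℝ} (hu : 0 < u) (huv : u ≤ v)
    (hnonpos : ∀ t ∈ Icc u v, t ^ 2 - t + a ≤ 0) :
    ∫ t in u..v, 2 * t * gapProfile a t = 0 := by
  refine intervalIntegral.integral_zero_ae (ae_of_all _ fun t ht => ?_)
  rw [uIoc_of_le huv] at ht
  rw [gapProfile_of_nonpos (hu.trans ht.1).ne' (hnonpos t (Ioc_subset_Icc_self ht)), mul_zero]

lemma gapIntegral_of_one_le (ha : 1 ≤ a) : gapIntegral a = 1 := by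
  rw [gapIntegral, integral_mul_gapProfile_of_le zero_le_one ha, one_pow]

lemma gapIntegral_of_mem_Icc (ha : a ∈ Icc (1 / 4) 1) :
    gapIntegral a = -1 + 2 * a - 2 * a * Real.log a := by
  have ha₀ : 0 < a := by linarith [ha.1]
  rw [gapIntegral, ← intervalIntegral.integral_add_adjacent_intervals
    (intervalIntegrable_mul_gapProfile ha₀ 0 a) (intervalIntegrable_mul_gapProfile ha₀ a 1),
    integral_mul_gapProfile_of_le ha₀.le le_rfl, integral_mul_gapProfile_of_nonneg ha₀ le_rfl ha.2
      fun t _ => by nlinarith [sq_nonneg (t - 1 / 2), ha.1], Real.log_one]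
  ring

lemma gapIntegral_of_le_quarter (ha₀ : 0 < a) (ha : a ≤ 1 / 4) :
    gapIntegral a = -1 + 2 * a + 2 * √(1 / 4 - a) - 4 * a * Real.log (1 / 2 + √(1 / 4 - a)) := by
  -- `1 / 2 ± w` are the roots of `t ^ 2 - t + a`.
  set w := √(1 / 4 - a)
  have hw₀ : 0 ≤ w := Real.sqrt_nonneg _
  have hw₂ : w ^ 2 = 1 / 4 - a := Real.sq_sqrt (by linarith)
  have hw₁ : w < 1 / 2 := by nlinarith
  have haw : a ≤ 1 / 2 - w := by nlinarith
  have hlog : Real.log a = Real.log (1 / 2 - w) + Real.log (1 / 2 + w) := by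
    rw [← Real.log_mul (by linarith) (by linarith)]
    congr 1
    linarith
  have hint := intervalIntegrable_mul_gapProfile ha₀
  have hsplit : gapIntegral a = (∫ t in (0 : ℝ)..a, 2 * t * gapProfile a t) +
      (∫ t in a..(1 / 2 - w), 2 * t * gapProfile a t) +
      (∫ t in (1 / 2 - w)..(1 / 2 + w), 2 * t * gapProfile a t) +
      ∫ t in (1 / 2 + w)..1, 2 * t * gapProfile a t := by
    rw [intervalIntegral.integral_add_adjacent_intervals (hint _ _) (hint _ _),
      intervalIntegral.integral_add_adjacent_intervals (hint _ _) (hint _ _),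
      intervalIntegral.integral_add_adjacent_intervals (hint _ _) (hint _ _), gapIntegral]
  rw [hsplit, integral_mul_gapProfile_of_le ha₀.le le_rfl,
    integral_mul_gapProfile_of_nonneg ha₀ le_rfl haw fun t ht => by nlinarith [ht.1, ht.2],
    integral_mul_gapProfile_of_nonpos (by linarith) (by linarith)
      fun t ht => by nlinarith [ht.1, ht.2],
    integral_mul_gapProfile_of_nonneg ha₀ (by linarith) (by linarith)
      fun t ht => by nlinarith [ht.1, ht.2], hlog, Real.log_one]
  ring

lemma hasDerivAt_gapFormula_middle (ha : a ≠ 0) :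
    HasDerivAt (fun a : ℝ => -1 + 2 * a - 2 * a * Real.log a) (-2 * Real.log a) a := by
  have hlin := (hasDerivAt_id' a).const_mul 2
  refine ((hlin.const_add (-1)).sub (hlin.mul (Real.hasDerivAt_log ha))).congr_deriv ?_
  field_simp
  ring

lemma hasDerivAt_gapFormula_small (ha : a < 1 / 4) :
    HasDerivAt
      (fun a : ℝ => -1 + 2 * a + 2 * √(1 / 4 - a) - 4 * a * Real.log (1 / 2 + √(1 / 4 - a)))
      (-4 * Real.log (1 / 2 + √(1 / 4 - a))) a := by
  have hw₀ : 0 < √(1 / 4 - a) := Real.sqrt_pos.2 (by linarith)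
  have hw₂ : √(1 / 4 - a) ^ 2 = 1 / 4 - a := Real.sq_sqrt (by linarith)
  have hid := hasDerivAt_id' a
  have hsqrt := (hid.const_sub (1 / 4)).sqrt (by linarith)
  have hlog := (hsqrt.const_add (1 / 2)).log (by positivity)
  refine ((((hid.const_mul 2).const_add (-1)).add (hsqrt.const_mul 2)).sub
    ((hid.const_mul 4).mul hlog)).congr_deriv ?_
  generalize √(1 / 4 - a) = w at hw₀ hw₂
  obtain rfl : a = (1 / 2 - w) * (1 / 2 + w) := by linarith
  field_simp
  ring

lemma continuousAt_log_half_add_sqrt :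
    ContinuousAt (fun a : ℝ => Real.log (1 / 2 + √(1 / 4 - a))) a := by
  have hpos : 1 / 2 + √(1 / 4 - a) ≠ 0 := by positivity
  fun_prop (disch := assumption)

lemma neg_two_mul_log_quarter :
    -2 * Real.log (1 / 4) = -4 * Real.log (1 / 2 + √(1 / 4 - 1 / 4)) := by
  rw [sub_self, Real.sqrt_zero, add_zero, show (1 / 4 : ℝ) = (1 / 2) ^ 2 by norm_num, Real.log_pow]
  push_cast
  ring

lemma hasDerivWithinAt_gapFormula_small :
    HasDerivWithinAt
      (fun a : ℝ => -1 + 2 * a + 2 * √(1 / 4 - a) - 4 * a * Real.log (1 / 2 + √(1 / 4 - a)))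
      (-2 * Real.log (1 / 4)) (Iic (1 / 4)) (1 / 4) := by
  have hlog := continuousAt_log_half_add_sqrt (a := 1 / 4)
  refine hasDerivWithinAt_Iic_of_tendsto_deriv (s := Iio (1 / 4)) (fun a ha =>
    (hasDerivAt_gapFormula_small ha).differentiableAt.differentiableWithinAt)
    (ContinuousAt.continuousWithinAt (by fun_prop)) self_mem_nhdsWithin ?_
  rw [neg_two_mul_log_quarter]
  refine ((hlog.const_mul (-4)).tendsto.mono_left nhdsWithin_le_nhds).congr' ?_
  filter_upwards [self_mem_nhdsWithin] with a ha
  exact (hasDerivAt_gapFormula_small ha).deriv.symm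

lemma hasDerivAt_of_eqOn_Ioc_of_eqOn_Ico {f f₁ f₂ : ℝ → ℝ} {f' l c u : ℝ} (hl : l < c)
    (hu : c < u) (h₁ : HasDerivWithinAt f₁ f' (Iic c) c) (h₂ : HasDerivWithinAt f₂ f' (Ici c) c)
    (he₁ : EqOn f f₁ (Ioc l c)) (he₂ : EqOn f f₂ (Ico c u)) : HasDerivAt f f' c := by
  have hunion := ((h₁.mono Ioc_subset_Iic_self).congr he₁ (he₁ (right_mem_Ioc.2 hl))).union
    ((h₂.mono Ico_subset_Ici_self).congr he₂ (he₂ (left_mem_Ico.2 hu)))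
  rw [Ioc_union_Ico_eq_Ioo hl hu] at hunion
  exact hunion.hasDerivAt (Ioo_mem_nhds hl hu)

lemma hasDerivAt_gapIntegral_of_mem_Icc (ha : a ∈ Icc (1 / 4) 1) :
    HasDerivAt gapIntegral (-2 * Real.log a) a := by
  have hformula := hasDerivAt_gapFormula_middle (a := a) (by linarith [ha.1])
  rcases ha.1.eq_or_lt with rfl | hlow
  · exact hasDerivAt_of_eqOn_Ioc_of_eqOn_Ico (by norm_num) (by norm_num)
      hasDerivWithinAt_gapFormula_small hformula.hasDerivWithinAt
      (fun b hb => gapIntegral_of_le_quarter hb.1 hb.2)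
      (fun b hb => gapIntegral_of_mem_Icc (Ico_subset_Icc_self hb))
  rcases ha.2.eq_or_lt with rfl | hhigh
  · exact hasDerivAt_of_eqOn_Ioc_of_eqOn_Ico hlow one_lt_two hformula.hasDerivWithinAt
      (by simpa using hasDerivWithinAt_const (1 : ℝ) (Ici 1) (1 : ℝ))
      (fun b hb => gapIntegral_of_mem_Icc (Ioc_subset_Icc_self hb))
      (fun b hb => gapIntegral_of_one_le hb.1)
  · refine hformula.congr_of_eventuallyEq ?_
    filter_upwards [Icc_mem_nhds hlow hhigh] with b hb using gapIntegral_of_mem_Icc hb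

lemma hasDerivAt_gapIntegral_of_one_le (ha : 1 ≤ a) : HasDerivAt gapIntegral 0 a := by
  rcases ha.eq_or_lt with rfl | hlt
  · simpa using hasDerivAt_gapIntegral_of_mem_Icc (a := 1) (by norm_num)
  · refine (hasDerivAt_const a (1 : ℝ)).congr_of_eventuallyEq ?_
    filter_upwards [Ici_mem_nhds hlt] with b hb using gapIntegral_of_one_le hb

lemma hasDerivAt_gapIntegral_of_le_quarter (ha₀ : 0 < a) (ha : a ≤ 1 / 4) :
    HasDerivAt gapIntegral (-4 * Real.log (1 / 2 + √(1 / 4 - a))) a := by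
  rcases ha.eq_or_lt with rfl | hlt
  · rw [← neg_two_mul_log_quarter]
    exact hasDerivAt_gapIntegral_of_mem_Icc (by norm_num)
  · refine (hasDerivAt_gapFormula_small hlt).congr_of_eventuallyEq ?_
    filter_upwards [Ioo_mem_nhds ha₀ hlt] with b hb using gapIntegral_of_le_quarter hb.1 hb.2.le

lemma hasDerivAt_gapParam {s : ℝ} (hs : s ≠ 0) :
    HasDerivAt gapParam (-(Real.pi ^ 2 / 3 * gapParam s ^ 2)) s := by
  refine (((hasDerivAt_id' s).const_mul (Real.pi ^ 2 / 3)).inv (by positivity)).congr_deriv ?_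
  rw [gapParam]
  field_simp

lemma hasDerivAt_neg_P0 {s E : ℝ} (hs : 0 < s) (hE : HasDerivAt gapIntegral E (gapParam s)) :
    HasDerivAt (fun t : ℝ => -P0 0 (Ioc 0 t)) (E * (Real.pi ^ 2 / 3 * gapParam s ^ 2)) s := by
  refine ((hE.comp s (hasDerivAt_gapParam hs.ne')).neg.congr_of_eventuallyEq ?_).congr_deriv
    (by ring)
  filter_upwards [lt_mem_nhds hs] with t ht
  rw [P0_eq_gapIntegral ht]
  rfl

end ExplicitFormula

end Farey

theorem mainTheorem3 (s a : ℝ) (hs : 0 < s) (ha : a = (Real.pi ^ 2 / 3 * s)⁻¹) :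
    -- `P_0(0, (0, s])` is the limiting gap distribution, whatever the test set `D`
    (∀ D : Set UnitAddCircle, volume (frontier D) = 0 → (interior D).Nonempty →
      Tendsto (fun Q : ℕ => Farey.P0Q Q 0 D (Ioc 0 s)) atTop (𝓝 (Farey.P0 0 (Ioc 0 s)))) ∧
    -- its explicit value
    (1 ≤ a → Farey.P0 0 (Ioc 0 s) = 1) ∧
    (1 / 4 ≤ a → a ≤ 1 → Farey.P0 0 (Ioc 0 s) = -1 + 2 * a - 2 * a * Real.log a) ∧
    (a ≤ 1 / 4 → Farey.P0 0 (Ioc 0 s) =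
      -1 + 2 * a + 2 * Real.sqrt (1 / 4 - a)
        - 4 * a * Real.log (1 / 2 + Real.sqrt (1 / 4 - a))) ∧
    -- its density `-d/ds P_0(0, (0, s])`
    (1 ≤ a → HasDerivAt (fun t : ℝ => -Farey.P0 0 (Ioc 0 t)) 0 s) ∧
    (1 / 4 ≤ a → a ≤ 1 → HasDerivAt (fun t : ℝ => -Farey.P0 0 (Ioc 0 t))
      (-(2 * Real.pi ^ 2 / 3) * a ^ 2 * Real.log a) s) ∧
    (a ≤ 1 / 4 → HasDerivAt (fun t : ℝ => -Farey.P0 0 (Ioc 0 t))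
      (-(4 * Real.pi ^ 2 / 3) * a ^ 2 * Real.log (1 / 2 + Real.sqrt (1 / 4 - a))) s) := by
  obtain rfl : a = Farey.gapParam s := ha
  have ha₀ := Farey.gapParam_pos hs
  have hP := Farey.P0_eq_gapIntegral hs
  refine ⟨fun D hD hDi => ?_, fun h => ?_, fun h h' => ?_, fun h => ?_, fun h => ?_,
    fun h h' => ?_, fun h => ?_⟩
  · rw [hP]
    exact Farey.tendsto_P0Q hs hD hDi
  · rw [hP, Farey.gapIntegral_of_one_le h]
  · rw [hP, Farey.gapIntegral_of_mem_Icc ⟨h, h'⟩]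
  · rw [hP, Farey.gapIntegral_of_le_quarter ha₀ h]
  · simpa using Farey.hasDerivAt_neg_P0 hs (Farey.hasDerivAt_gapIntegral_of_one_le h)
  · convert Farey.hasDerivAt_neg_P0 hs (Farey.hasDerivAt_gapIntegral_of_mem_Icc ⟨h, h'⟩) using 1
    ring
  · convert Farey.hasDerivAt_neg_P0 hs (Farey.hasDerivAt_gapIntegral_of_le_quarter ha₀ h) using 1
    ring

end
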